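/- For $\rho\in\mathbb{R}$ put $r_0:=\dfrac{\left[y_0\left(y_0^2+2|\sin\rho|\,y_0+1\right)\right]^{1/2}}{y_0+1}$ with $y_0:=0.2$, and for $t>0$ put $$f(t):=[t(t^2+1+2t\sin\rho)]^{1/2},\qquad \tilde f(t):=[t(t^2+1-2t\sin\rho)]^{1/2}.$$ Then for every $\rho\in(-0.01,0)$ there are $\lambda>1$ and $r>0$ with $\lambda r<r_0$ (so in particular $(\lambda,r)\in(1,\infty)\times(0,r_0)$) such that the following holds. There is exactly one complex number $x=a+ib$ with $a>0$ and $$\frac{-ix\,(x-e^{i\rho})(x+e^{-i\rho})}{(x+\lambda i)^2}=r^2,$$ and for this $x$ the three quantities $$c_1:=\frac{(\lambda+b)^2+a^2}{2af(\lambda)r-r^2[(\lambda+b)^2+a^2]},\qquad c_2:=\frac{\displaystyle\int_0^\infty\frac{(\lambda-t)\,dt}{f(t)[(t+b)^2+a^2]}}{\displaystyle\mathrm{p.v.}\!\!\int_0^\infty\frac{f(t)\,dt}{(t-\lambda)[(t+b)^2+a^2]}},$$ $$c_3:=\frac{\displaystyle\int_0^\infty\frac{(t+\lambda)\,dt}{\tilde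 f(t)[(t-b)^2+a^2]}}{\displaystyle\frac{\pi f(\lambda)}{(\lambda+b)^2+a^2}-\int_0^\infty\frac{\tilde f(t)\,dt}{(t+\lambda)[(t-b)^2+a^2]}}$$ are well defined (the improper integrals converge absolutely, the Cauchy principal value at $t=\lambda$ exists, and the denominators are nonzero), positive, and equal: $c_1=c_2=c_3>0$. -/

import Mathlib

open Set Filter MeasureTheory
open scoped Topology

noncomputable section

namespace ScherkCosta

/-- The function `f(t) = [t (t² + 1 + 2 t sin ρ)]^(1/2)`, for positive `t`. -/
def f (ρ t : ℝ) : ℝ := √(t * (t ^ 2 + 1 + 2 * t * Real.sin ρ))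

/-- The function `f̃(t) = [t (t² + 1 - 2 t sin ρ)]^(1/2)`, for positive `t`. -/
def fTilde (ρ t : ℝ) : ℝ := √(t * (t ^ 2 + 1 - 2 * t * Real.sin ρ))

/-- The constant `y₀ = 0.2`. -/
def y0 : ℝ := 1 / 5

/-- The bound `r₀ = [y₀ (y₀² + 2 |sin ρ| y₀ + 1)]^(1/2) / (y₀ + 1)`. -/
def r0 (ρ : ℝ) : ℝ := √(y0 * (y0 ^ 2 + 2 * |Real.sin ρ| * y0 + 1)) / (y0 + 1)

/-- `x` is the location, in the right half plane, of the Scherk ends of parameters `ρ, lam, r`: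
it has positive real part and
`-i x (x - e^{iρ}) (x + e^{-iρ}) / (x + lam i)² = r²`.
The denominator does not vanish, since the real part of `x` is not zero. -/
def IsScherkEnd (ρ lam r : ℝ) (x : ℂ) : Prop :=
  0 < x.re ∧
    -Complex.I * x * (x - Complex.exp (Complex.I * ρ)) * (x + Complex.exp (-(Complex.I * ρ))) /
      (x + lam * Complex.I) ^ 2 = (r : ℂ) ^ 2

/-- `v` is the Cauchy principal value of the integral of `g` over `(0, ∞)`, with a singularity
at the point `p`: the limit, as `δ → 0⁺`, of the integrals (absolutely convergent) over
`(0, ∞) ∖ (p - δ, p + δ)`. -/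
def HasPVIntegral (g : ℝ → ℝ) (p v : ℝ) : Prop :=
  (∀ δ : ℝ, 0 < δ → IntegrableOn g (Ioi 0 \ Ioo (p - δ) (p + δ))) ∧
    Tendsto (fun δ : ℝ => ∫ t in Ioi 0 \ Ioo (p - δ) (p + δ), g t) (𝓝[>] 0) (𝓝 v)

/-- Integrand of the numerator in the first period condition. -/
def integrandI1 (ρ lam a b t : ℝ) : ℝ := (lam - t) / (f ρ t * ((t + b) ^ 2 + a ^ 2))

/-- Integrand of the denominator in the first period condition (singular at `t = lam`). -/
def integrandI2 (ρ lam a b t : ℝ) : ℝ := f ρ t / ((t - lam) * ((t + b) ^ 2 + a ^ 2))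

/-- Integrand of the numerator in the second period condition. -/
def integrandJ1 (ρ lam a b t : ℝ) : ℝ := (t + lam) / (fTilde ρ t * ((t - b) ^ 2 + a ^ 2))

/-- Integrand in the denominator of the second period condition. -/
def integrandJ2 (ρ lam a b t : ℝ) : ℝ := fTilde ρ t / ((t + lam) * ((t - b) ^ 2 + a ^ 2))

/-- The value of `c²` in the residue condition. -/
def c1 (ρ lam r a b : ℝ) : ℝ :=
  ((lam + b) ^ 2 + a ^ 2) / (2 * a * f ρ lam * r - r ^ 2 * ((lam + b) ^ 2 + a ^ 2))

/-- `C` is the value of `c²` in the first period condition: the numerator integral converges,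
the denominator integral exists as a principal value and is not zero, and `C` is the quotient. -/
def IsC2 (ρ lam a b C : ℝ) : Prop :=
  IntegrableOn (integrandI1 ρ lam a b) (Ioi 0) ∧
    ∃ I2 : ℝ, HasPVIntegral (integrandI2 ρ lam a b) lam I2 ∧ I2 ≠ 0 ∧
      C = (∫ t in Ioi 0, integrandI1 ρ lam a b t) / I2

/-- `C` is the value of `c²` in the second period condition: both integrals converge,
the denominator is not zero, and `C` is the quotient. -/
def IsC3 (ρ lam a b C : ℝ) : Prop :=
  IntegrableOn (integrandJ1 ρ lam a b) (Ioi 0) ∧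
    IntegrableOn (integrandJ2 ρ lam a b) (Ioi 0) ∧
      Real.pi * f ρ lam / ((lam + b) ^ 2 + a ^ 2) -
        (∫ t in Ioi 0, integrandJ2 ρ lam a b t) ≠ 0 ∧
      C = (∫ t in Ioi 0, integrandJ1 ρ lam a b t) /
        (Real.pi * f ρ lam / ((lam + b) ^ 2 + a ^ 2) -
          ∫ t in Ioi 0, integrandJ2 ρ lam a b t)

end ScherkCosta

end

/-! Put σ = -sin ρ, so 0 < σ < 1/100, and ε = 1/λ. With x = iw the equation of the Scherk end
becomes the real cubic w³ + 2σw² + w = r²(w + λ)², with one real root p and two roots b ± ia.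
Evaluated at w = -t, its factorization reads f(t)² = (t + p)((t + b)² + a²) - r²(t - λ)²
(`f_sq_identity`). Dividing by f(t)(t - λ)((t + b)² + a²) splits the denominator of c₂ into r² times
its numerator plus the principal value of (t + p)/(f(t)(t - λ)). Since p.v.∫ dt/(√t(t - λ)) = 0, a
constant multiple of that kernel can be subtracted, which leaves the integral A of a regular
difference quotient. At -t the same identity, with ∫ dt/(√t(t + λ)) = π/√λ absorbing the π-term,
writes the denominator of c₃ as E - r²J, where J is its numerator and E is again regular. With I the
numerator of c₂ and H = f(λ)/((λ + b)² + a²), the reciprocals of c₁, c₂, c₃ are 2aHr - r², r² + A/I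
and E/J - r². Equality means E = 2aHrJ and A = (2aHr - 2r²)I (`periods_of_reduced`).

Taking ε and p = κ²ε as unknowns makes r, a, b explicit. The two equations become `Gfun` = 0 and,
after eliminating with the first, `Ffun` = 0, on the rectangle σ/10 ≤ ε ≤ 1/10, 0.3 ≤ κ ≤ 0.57.
`Gfun` changes sign between κ = 0.3 and κ = 0.57. `Ffun` vanishes to order zero in (σ, ε), and there
σ and ε act in opposite directions: it is positive when σ = 10ε and negative when ε = 1/10. The
Poincaré–Miranda theorem gives a common zero.

The signs come from comparing every integrand with its value at σ = ε = p = 0, where √(t² ∓ 2σt + 1)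
becomes S = √(1 + t²). Integration by parts reduces the comparison integrals to two constants, `K`
and `cc`, which polynomial bounds enclose. -/

noncomputable section

/-! ### The Poincaré–Miranda theorem in the plane -/

/-- A continuous real function whose cosine does not vanish on an interval varies by less
than `π` on it. -/
theorem abs_sub_lt_pi_of_cos_ne_zero {φ : ℝ → ℝ} {u v : ℝ} (huv : u ≤ v) (hφ : Continuous φ)
    (h : ∀ x ∈ Icc u v, Real.cos (φ x) ≠ 0) : |φ v - φ u| < Real.pi := by
  by_contra! hge
  have hpi := Real.pi_pos
  set m := min (φ u) (φ v) with hm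
  have hM : m + Real.pi ≤ max (φ u) (φ v) := by
    have := max_sub_min_eq_abs (φ u) (φ v)
    linarith
  -- kπ + π/2 is the first zero of the cosine at or above m, so it lies in [m, m + π).
  set k : ℤ := ⌈(m - Real.pi / 2) / Real.pi⌉ with hk
  have h1 : (m - Real.pi / 2) / Real.pi ≤ k := Int.le_ceil _
  have h2 : (k : ℝ) < (m - Real.pi / 2) / Real.pi + 1 := Int.ceil_lt_add_one _
  rw [div_le_iff₀ hpi] at h1
  have h2' : (k : ℝ) * Real.pi < m - Real.pi / 2 + Real.pi := by
    have := mul_lt_mul_of_pos_right h2 hpi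
    rwa [add_mul, div_mul_cancel₀ _ hpi.ne', one_mul] at this
  have hmem : (k : ℝ) * Real.pi + Real.pi / 2 ∈ uIcc (φ u) (φ v) := by
    rw [uIcc, mem_Icc]
    constructor
    · change m ≤ _
      linarith
    · change _ ≤ max (φ u) (φ v)
      linarith
  obtain ⟨x, hx, hxe⟩ := intermediate_value_uIcc (hφ.continuousOn (s := uIcc u v)) hmem
  rw [uIcc_of_le huv] at hx
  refine h x hx ?_
  rw [hxe, Real.cos_add_pi_div_two, Real.sin_int_mul_pi, neg_zero]

theorem lt_of_sin_sub_pos {x y : ℝ} (h : |y - x| < Real.pi) (hs : 0 < Real.sin (y - x)) :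
    x < y := by
  by_contra! hle
  have := Real.sin_nonpos_of_nonpos_of_neg_pi_le (x := y - x) (by linarith)
    (by linarith [(abs_lt.mp h).1])
  linarith

theorem lt_of_abs_sub_lt_pi {x y : ℝ} (h : |y - x| < Real.pi)
    (hs : 0 < Real.sin y * Real.cos x - Real.cos y * Real.sin x) : x < y :=
  lt_of_sin_sub_pos h (by rwa [Real.sin_sub])

/-- The Poincaré–Miranda theorem in the plane, for functions continuous on the whole plane. -/
theorem exists_common_zero_of_continuous {F G : ℝ × ℝ → ℝ} {a b c d : ℝ} (hab : a ≤ b)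
    (hcd : c ≤ d) (hF : Continuous F) (hG : Continuous G)
    (hFa : ∀ y ∈ Icc c d, F (a, y) < 0) (hFb : ∀ y ∈ Icc c d, 0 < F (b, y))
    (hGc : ∀ x ∈ Icc a b, G (x, c) < 0) (hGd : ∀ x ∈ Icc a b, 0 < G (x, d)) :
    ∃ z, F z = 0 ∧ G z = 0 := by
  by_contra! hne
  let g : ℝ × ℝ → ℂ := fun z => ⟨F z, G z⟩
  have hg : Continuous g := by
    have : g = fun z => (F z : ℂ) + G z * Complex.I := by
      funext z
      apply Complex.ext <;> simp [g]
    rw [this]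
    fun_prop
  have hg0 : (0 : ℂ) ∉ g '' univ := by
    rintro ⟨z, -, hz⟩
    have h1 := congrArg Complex.re hz
    have h2 := congrArg Complex.im hz
    exact hne z (by simpa [g] using h1) (by simpa [g] using h2)
  have hsc : IsSimplyConnected (univ : Set (ℝ × ℝ)) := by
    have : ContractibleSpace (univ : Set (ℝ × ℝ)) :=
      convex_univ.contractibleSpace univ_nonempty
    exact SimplyConnectedSpace.ofContractible _
  -- Without a common zero, F + iG has a continuous logarithm on the plane, whose imaginary part θ
  -- is a global argument.
  obtain ⟨L, hL, hLg⟩ := Complex.exists_continuousOn_eqOn_exp_comp hsc isOpen_univ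
    hg.continuousOn hg0
  replace hL := continuousOn_univ.mp hL
  let θ : ℝ × ℝ → ℝ := fun z => (L z).im
  have hθ : Continuous θ := Complex.continuous_im.comp hL
  have hre : ∀ z, Real.exp (L z).re * Real.cos (θ z) = F z := fun z => by
    have := congrArg Complex.re (hLg (mem_univ z))
    simpa [g, Complex.exp_re] using this
  have him : ∀ z, Real.exp (L z).re * Real.sin (θ z) = G z := fun z => by
    have := congrArg Complex.im (hLg (mem_univ z))
    simpa [g, Complex.exp_im] using this
  have cpos : ∀ z, 0 < F z → 0 < Real.cos (θ z) := fun z h => by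
    rw [← hre z] at h
    exact pos_of_mul_pos_right h (Real.exp_pos _).le
  have cneg : ∀ z, F z < 0 → Real.cos (θ z) < 0 := fun z h => by
    rw [← hre z] at h
    exact neg_of_mul_neg_right h (Real.exp_pos _).le
  have spos : ∀ z, 0 < G z → 0 < Real.sin (θ z) := fun z h => by
    rw [← him z] at h
    exact pos_of_mul_pos_right h (Real.exp_pos _).le
  have sneg : ∀ z, G z < 0 → Real.sin (θ z) < 0 := fun z h => by
    rw [← him z] at h
    exact neg_of_mul_neg_right h (Real.exp_pos _).le
  have hc := left_mem_Icc.mpr hcd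
  have hd := right_mem_Icc.mpr hcd
  have ha := left_mem_Icc.mpr hab
  have hb := right_mem_Icc.mpr hab
  have vert : ∀ x, (∀ y ∈ Icc c d, Real.cos (θ (x, y)) ≠ 0) →
      |θ (x, d) - θ (x, c)| < Real.pi := fun x h =>
    abs_sub_lt_pi_of_cos_ne_zero (φ := fun y => θ (x, y)) hcd (by fun_prop) h
  have horiz : ∀ y, (∀ x ∈ Icc a b, Real.sin (θ (x, y)) ≠ 0) →
      |θ (b, y) - θ (a, y)| < Real.pi := fun y h => by
    have := abs_sub_lt_pi_of_cos_ne_zero (φ := fun x => θ (x, y) - Real.pi / 2) hab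
      (by fun_prop) (fun x hx => by rw [Real.cos_sub_pi_div_two]; exact h x hx)
    simpa using this
  have e1 := horiz c fun x hx => (sneg _ (hGc x hx)).ne
  have e2 := vert b fun y hy => (cpos _ (hFb y hy)).ne'
  have e3 := horiz d fun x hx => (spos _ (hGd x hx)).ne'
  have e4 := vert a fun y hy => (cneg _ (hFa y hy)).ne
  rw [abs_sub_comm] at e3 e4
  have c1 := cneg _ (hFa c hc)
  have c2 := cpos _ (hFb c hc)
  have c3 := cpos _ (hFb d hd)
  have c4 := cneg _ (hFa d hd)
  have s1 := sneg _ (hGc a ha)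
  have s2 := sneg _ (hGc b hb)
  have s3 := spos _ (hGd b hb)
  have s4 := spos _ (hGd a ha)
  -- On each side F + iG stays in an open half-plane, so θ varies by less than π there. The
  -- quadrants of the corners then make θ strictly increase along each side, counterclockwise, which
  -- is impossible around a closed loop.
  have l1 := lt_of_abs_sub_lt_pi e1 (by nlinarith)
  have l2 := lt_of_abs_sub_lt_pi e2 (by nlinarith)
  have l3 := lt_of_abs_sub_lt_pi e3 (by nlinarith)
  have l4 := lt_of_abs_sub_lt_pi e4 (by nlinarith)
  linarith

/-- The Poincaré–Miranda theorem in the plane. -/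
theorem exists_common_zero {F G : ℝ × ℝ → ℝ} {a b c d : ℝ} (hab : a ≤ b)
    (hcd : c ≤ d) (hF : ContinuousOn F (Icc a b ×ˢ Icc c d))
    (hG : ContinuousOn G (Icc a b ×ˢ Icc c d))
    (hFa : ∀ y ∈ Icc c d, F (a, y) < 0) (hFb : ∀ y ∈ Icc c d, 0 < F (b, y))
    (hGc : ∀ x ∈ Icc a b, G (x, c) < 0) (hGd : ∀ x ∈ Icc a b, 0 < G (x, d)) :
    ∃ x ∈ Icc a b, ∃ y ∈ Icc c d, F (x, y) = 0 ∧ G (x, y) = 0 := by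
  -- Composing with the retraction onto the rectangle extends both functions continuously to the
  -- plane.
  let P : ℝ × ℝ → ℝ × ℝ := fun z => (projIcc a b hab z.1, projIcc c d hcd z.2)
  have hP : Continuous P := by
    refine Continuous.prodMk ?_ ?_
    · exact continuous_subtype_val.comp (continuous_projIcc.comp continuous_fst)
    · exact continuous_subtype_val.comp (continuous_projIcc.comp continuous_snd)
  have hPm : ∀ z, P z ∈ Icc a b ×ˢ Icc c d := fun z => ⟨Subtype.coe_prop _, Subtype.coe_prop _⟩
  have hPid : ∀ x ∈ Icc a b, ∀ y ∈ Icc c d, P (x, y) = (x, y) := fun x hx y hy => by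
    simp only [P, projIcc_of_mem hab hx, projIcc_of_mem hcd hy]
  have ha := left_mem_Icc.mpr hab
  have hb := right_mem_Icc.mpr hab
  have hc := left_mem_Icc.mpr hcd
  have hd := right_mem_Icc.mpr hcd
  obtain ⟨z, h1, h2⟩ := exists_common_zero_of_continuous (F := F ∘ P) (G := G ∘ P) hab hcd
    (hF.comp_continuous hP hPm) (hG.comp_continuous hP hPm)
    (fun y hy => by simpa only [Function.comp, hPid a ha y hy] using hFa y hy)
    (fun y hy => by simpa only [Function.comp, hPid b hb y hy] using hFb y hy)
    (fun x hx => by simpa only [Function.comp, hPid x hx c hc] using hGc x hx)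
    (fun x hx => by simpa only [Function.comp, hPid x hx d hd] using hGd x hx)
  exact ⟨(P z).1, (hPm z).1, (P z).2, (hPm z).2, h1, h2⟩

namespace ScherkCosta

/-! ### Integrals for the measure dt/√t -/

/-- `S t = √(1 + t²)`. -/
def S (t : ℝ) : ℝ := √(1 + t ^ 2)

theorem S_sq (t : ℝ) : S t ^ 2 = 1 + t ^ 2 := Real.sq_sqrt (by positivity)

theorem S_pos (t : ℝ) : 0 < S t := Real.sqrt_pos.mpr (by positivity)

theorem one_le_S (t : ℝ) : 1 ≤ S t := Real.one_le_sqrt.mpr (by nlinarith [sq_nonneg t])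

theorem le_S (t : ℝ) : t ≤ S t := Real.le_sqrt_of_sq_le (by linarith)

theorem S_le {t : ℝ} (ht : 0 ≤ t) : S t ≤ 1 + t :=
  Real.sqrt_le_iff.mpr ⟨by linarith, by nlinarith⟩

theorem continuous_S : Continuous S := by
  unfold S
  fun_prop

theorem hasDerivAt_S (t : ℝ) : HasDerivAt S (t / S t) t := by
  have h : HasDerivAt (fun t : ℝ => 1 + t ^ 2) (2 * t) t := by
    simpa using ((hasDerivAt_id t).pow 2).const_add 1
  refine (h.sqrt (by positivity)).congr_deriv ?_
  rw [mul_div_mul_left _ _ two_ne_zero, S]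

/-- The integral of `g` over `(0, ∞)` for the measure `dt / √t`. -/
def hInt (g : ℝ → ℝ) : ℝ := ∫ t in Ioi 0, g t / √t

/-- Integrability over `(0, ∞)` for the measure `dt / √t`. -/
def HInt (g : ℝ → ℝ) : Prop := IntegrableOn (fun t => g t / √t) (Ioi 0)

theorem HInt.add {g h : ℝ → ℝ} (hg : HInt g) (hh : HInt h) : HInt (fun t => g t + h t) := by
  unfold HInt
  simp only [add_div]
  exact Integrable.add hg hh

theorem HInt.const_mul {g : ℝ → ℝ} (hg : HInt g) (c : ℝ) : HInt (fun t => c * g t) := by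
  unfold HInt
  simp only [mul_div_assoc]
  exact Integrable.const_mul hg c

theorem hInt_add {g h : ℝ → ℝ} (hg : HInt g) (hh : HInt h) :
    hInt (fun t => g t + h t) = hInt g + hInt h := by
  unfold hInt
  simp only [add_div]
  exact integral_add hg hh

theorem hInt_const_mul (g : ℝ → ℝ) (c : ℝ) : hInt (fun t => c * g t) = c * hInt g := by
  unfold hInt
  simp only [mul_div_assoc]
  exact integral_const_mul c _

theorem hInt_congr {g h : ℝ → ℝ} (hgh : ∀ t, 0 < t → g t = h t) : hInt g = hInt h := by
  refine setIntegral_congr_fun measurableSet_Ioi fun t ht => ?_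
  simp only [hgh t ht]

theorem HInt.congr {g h : ℝ → ℝ} (hg : HInt g) (hgh : ∀ t, 0 < t → g t = h t) : HInt h := by
  refine IntegrableOn.congr_fun hg (fun t ht => ?_) measurableSet_Ioi
  simp only [hgh t ht]

theorem hInt_mono {g h : ℝ → ℝ} (hg : HInt g) (hh : HInt h)
    (hgh : ∀ t, 0 < t → g t ≤ h t) : hInt g ≤ hInt h := by
  refine setIntegral_mono_on hg hh measurableSet_Ioi fun t ht => ?_
  have := hgh t ht
  gcongr

theorem pow_div_sqrt {t : ℝ} (ht : 0 < t) (k : ℕ) : t ^ k / √t = t ^ ((k : ℝ) - 1 / 2) := by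
  rw [Real.rpow_sub ht, Real.rpow_natCast, Real.sqrt_eq_rpow]

theorem inv_pow_div_sqrt {t : ℝ} (ht : 0 < t) (k : ℕ) :
    t⁻¹ ^ k / √t = t ^ (-(k : ℝ) - 1 / 2) := by
  rw [Real.rpow_sub ht, Real.rpow_neg ht.le, Real.rpow_natCast, Real.sqrt_eq_rpow, inv_pow]

theorem integrableOn_Ioc_pow (k : ℕ) :
    IntegrableOn (fun t : ℝ => t ^ k / √t) (Ioc 0 1) := by
  have h := (intervalIntegral.intervalIntegrable_rpow' (a := 0) (b := 1)
    (r := (k : ℝ) - 1 / 2) (by have := k.cast_nonneg (α := ℝ); linarith))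
  rw [intervalIntegrable_iff_integrableOn_Ioc_of_le zero_le_one] at h
  exact h.congr_fun (fun t ht => (pow_div_sqrt ht.1 k).symm) measurableSet_Ioc

theorem integral_Ioc_pow (k : ℕ) :
    ∫ t in Ioc (0 : ℝ) 1, t ^ k / √t = 1 / ((k : ℝ) + 1 / 2) := by
  have hk := k.cast_nonneg (α := ℝ)
  have h := integral_rpow (a := 0) (b := 1) (r := (k : ℝ) - 1 / 2) (Or.inl (by linarith))
  rw [intervalIntegral.integral_of_le zero_le_one] at h
  rw [setIntegral_congr_fun measurableSet_Ioc (fun t ht => pow_div_sqrt ht.1 k), h,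
    Real.one_rpow, Real.zero_rpow (by linarith)]
  ring

theorem integrableOn_Ioi_inv_pow (k : ℕ) (hk : 1 ≤ k) :
    IntegrableOn (fun t : ℝ => t⁻¹ ^ k / √t) (Ioi 1) := by
  have hk : (1 : ℝ) ≤ k := by exact_mod_cast hk
  have h := integrableOn_Ioi_rpow_of_lt (a := -(k : ℝ) - 1 / 2) (by linarith) (c := 1) one_pos
  exact h.congr_fun (fun t ht => (inv_pow_div_sqrt (one_pos.trans ht) k).symm) measurableSet_Ioi

theorem integral_Ioi_inv_pow (k : ℕ) (hk : 1 ≤ k) :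
    ∫ t in Ioi (1 : ℝ), t⁻¹ ^ k / √t = 1 / ((k : ℝ) - 1 / 2) := by
  have hk : (1 : ℝ) ≤ k := by exact_mod_cast hk
  have h := integral_Ioi_rpow_of_lt (a := -(k : ℝ) - 1 / 2) (by linarith) (c := 1) one_pos
  rw [setIntegral_congr_fun measurableSet_Ioi
    (fun t ht => inv_pow_div_sqrt (one_pos.trans ht) k), h, Real.one_rpow]
  rw [← neg_div_neg_eq]
  congr 1 <;> ring

/-- The function 1/S is the common majorant for all later integrability and domination arguments: it
is at most 1 near 0 and at most 1/t near infinity. -/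
theorem hInt_one_div_S_exists : HInt (fun t => 1 / S t) := by
  unfold HInt
  rw [← Ioc_union_Ioi_eq_Ioi (zero_le_one (α := ℝ))]
  have hm : ∀ s : Set ℝ, AEStronglyMeasurable (fun t => 1 / S t / √t) (volume.restrict s) :=
    fun s => by
      have : Measurable (fun t => 1 / S t / √t) := by
        have := continuous_S.measurable
        fun_prop
      exact this.aestronglyMeasurable
  refine IntegrableOn.union ?_ ?_
  · refine Integrable.mono' (integrableOn_Ioc_pow 0) (hm _) ?_
    refine (ae_restrict_iff' measurableSet_Ioc).mpr (ae_of_all _ fun t ht => ?_)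
    have hS := S_pos t
    rw [Real.norm_of_nonneg (by positivity), pow_zero]
    gcongr
    exact (div_le_one hS).mpr (one_le_S t)
  · refine Integrable.mono' (integrableOn_Ioi_inv_pow 1 le_rfl) (hm _) ?_
    refine (ae_restrict_iff' measurableSet_Ioi).mpr (ae_of_all _ fun t ht => ?_)
    have ht0 : 0 < t := one_pos.trans ht
    have hS := S_pos t
    rw [Real.norm_of_nonneg (by positivity), pow_one, ← one_div]
    have h1 := one_div_le_one_div_of_le ht0 (le_S t)
    gcongr

theorem HInt.of_bound {g : ℝ → ℝ} {C : ℝ} (hg : ContinuousOn g (Ioi 0))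
    (h : ∀ t, 0 < t → |g t| ≤ C / S t) : HInt g := by
  refine Integrable.mono' (hInt_one_div_S_exists.const_mul C) ?_ ?_
  · refine ContinuousOn.aestronglyMeasurable ?_ measurableSet_Ioi
    refine hg.div Real.continuous_sqrt.continuousOn fun t ht => ?_
    exact (Real.sqrt_pos.mpr ht).ne'
  · refine (ae_restrict_iff' measurableSet_Ioi).mpr (ae_of_all _ fun t ht => ?_)
    rw [norm_div, Real.norm_eq_abs, Real.norm_of_nonneg (Real.sqrt_nonneg t)]
    have := h t ht
    rw [← mul_one_div] at this
    gcongr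

/-- The fundamental theorem of calculus for the measure `dt / √t`. -/
theorem hInt_eq_zero_of_hasDerivAt {G g : ℝ → ℝ} (hg : HInt g)
    (hG : ∀ t, 0 < t → HasDerivAt G (g t / √t) t)
    (hb : ∀ t, 0 ≤ t → |G t| ≤ √t / S t) : hInt g = 0 := by
  have hG0 : G 0 = 0 := by simpa using hb 0 le_rfl
  -- The bound √t/S forces the primitive to vanish at both ends.
  have h := integral_Ioi_of_hasDerivAt_of_tendsto (f := G) (f' := fun t => g t / √t) (a := 0)
    (m := 0) ?_ hG hg ?_
  · rw [hG0, sub_zero] at h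
    exact h
  · rw [ContinuousWithinAt, hG0]
    have hc : Tendsto (fun t => √t / S t) (𝓝[Ici 0] 0) (𝓝 0) := by
      have : Continuous (fun t => √t / S t) :=
        Real.continuous_sqrt.div continuous_S fun t => (S_pos t).ne'
      simpa [ContinuousWithinAt] using this.continuousWithinAt (s := Ici 0) (x := 0)
    refine squeeze_zero_norm' ?_ hc
    filter_upwards [self_mem_nhdsWithin] with t ht
    exact hb t ht
  · have hc : Tendsto (fun t : ℝ => (√t)⁻¹) atTop (𝓝 0) :=
      tendsto_inv_atTop_zero.comp Real.tendsto_sqrt_atTop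
    refine squeeze_zero_norm' ?_ hc
    filter_upwards [eventually_gt_atTop 0] with t ht
    refine (hb t ht.le).trans ?_
    have h1 := Real.sqrt_pos.mpr ht
    rw [inv_eq_one_div, div_le_div_iff₀ (S_pos t) h1, Real.mul_self_sqrt ht.le, one_mul]
    exact le_S t

/-! ### Reduction of the comparison integrals to two constants -/

/-- `K = ∫ dt / √(t (1 + t²))`. -/
def K : ℝ := hInt (fun t => 1 / S t)

/-- `cc = ∫ (1 - t / √(1 + t²)) dt / √t`. -/
def cc : ℝ := hInt (fun t => 1 / (S t * (S t + t)))

theorem S_ne (t : ℝ) : S t ≠ 0 := (S_pos t).ne'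

theorem one_sub_div_S {t : ℝ} (ht : 0 ≤ t) : 1 / (S t * (S t + t)) = 1 - t / S t := by
  have h := S_pos t
  have h2 := S_sq t
  field_simp
  nlinarith

theorem HInt_cube : HInt (fun t => 1 / S t ^ 3) := by
  refine HInt.of_bound (C := 1) ?_ fun t ht => ?_
  · exact (continuous_const.div (continuous_S.pow 3) fun t => pow_ne_zero 3 (S_ne t)).continuousOn
  · have h := S_pos t
    rw [abs_of_pos (by positivity)]
    gcongr
    exact le_self_pow₀ (one_le_S t) (by norm_num)

theorem HInt_t_cube : HInt (fun t => t / S t ^ 3) := by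
  refine HInt.of_bound (C := 1) ?_ fun t ht => ?_
  · exact (continuous_id.div (continuous_S.pow 3) fun t => pow_ne_zero 3 (S_ne t)).continuousOn
  · have h := S_pos t
    rw [abs_of_pos (by positivity), div_le_div_iff₀ (by positivity) h]
    have := le_S t
    have := one_le_S t
    nlinarith [mul_le_mul this (le_S t) ht.le h.le]

theorem HInt_t_five : HInt (fun t => t / S t ^ 5) := by
  refine HInt.of_bound (C := 1) ?_ fun t ht => ?_
  · exact (continuous_id.div (continuous_S.pow 5) fun t => pow_ne_zero 5 (S_ne t)).continuousOn
  · have h := S_pos t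
    rw [abs_of_pos (by positivity), div_le_div_iff₀ (by positivity) h, one_mul]
    have h2 := one_le_S t
    calc t * S t ≤ S t * S t := by gcongr; exact le_S t
      _ = S t ^ 2 := by ring
      _ ≤ S t ^ 5 := pow_le_pow_right₀ h2 (by norm_num)

theorem continuous_w0 : Continuous (fun t => S t * (S t + t)) :=
  continuous_S.mul (continuous_S.add continuous_id)

theorem w0_pos {t : ℝ} (ht : 0 < t) : 0 < S t * (S t + t) :=
  mul_pos (S_pos t) (by linarith [S_pos t])

theorem HInt_w0 : HInt (fun t => 1 / (S t * (S t + t))) := by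
  refine HInt.of_bound (C := 1) ?_ fun t ht => ?_
  · exact continuousOn_const.div continuous_w0.continuousOn fun t ht => (w0_pos ht).ne'
  · have h := S_pos t
    rw [abs_of_pos (by positivity)]
    gcongr
    nlinarith [one_le_S t]

theorem HInt_t_w0 : HInt (fun t => t / (S t * (S t + t))) := by
  refine HInt.of_bound (C := 1) ?_ fun t ht => ?_
  · exact continuousOn_id.div continuous_w0.continuousOn fun t ht => (w0_pos ht).ne'
  · have h := S_pos t
    rw [abs_of_pos (by positivity), div_le_div_iff₀ (by positivity) h]
    nlinarith [one_le_S t]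

theorem HInt_w0_sq : HInt (fun t => 1 / (S t * (S t + t) ^ 2)) := by
  refine HInt.of_bound (C := 1) ?_ fun t ht => ?_
  · refine continuousOn_const.div
      (continuous_S.mul ((continuous_S.add continuous_id).pow 2)).continuousOn fun t ht => ?_
    have : 0 < t := ht
    have := S_pos t
    positivity
  · have h := S_pos t
    rw [abs_of_pos (by positivity)]
    gcongr
    have h1 := one_le_S t
    have : 1 ≤ (S t + t) ^ 2 := one_le_pow₀ (by linarith)
    nlinarith

theorem hasDerivAt_sqrt' {t : ℝ} (ht : 0 < t) : HasDerivAt (fun t => √t) (1 / 2 / √t) t := by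
  convert Real.hasDerivAt_sqrt ht.ne' using 1
  rw [div_div]

theorem sqrt_ne {t : ℝ} (ht : 0 < t) : √t ≠ 0 := (Real.sqrt_pos.mpr ht).ne'

/-- Integration by parts: (√t/S)' = (1/S³ - 1/(2S))/√t, and the boundary terms vanish. The next
identities differ only in the primitive. -/
theorem hInt_cube : hInt (fun t => 1 / S t ^ 3) = K / 2 := by
  have h := hInt_eq_zero_of_hasDerivAt (G := fun t => √t / S t)
    (g := fun t => 1 / S t ^ 3 + (-(1 / 2)) * (1 / S t))
    (HInt_cube.add (hInt_one_div_S_exists.const_mul _)) (fun t ht => ?_) (fun t ht => ?_)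
  · rw [hInt_add HInt_cube (hInt_one_div_S_exists.const_mul _), hInt_const_mul] at h
    change _ + _ * K = 0 at h
    linarith
  · refine ((hasDerivAt_sqrt' ht).div (hasDerivAt_S t) (S_ne t)).congr_deriv ?_
    have h1 := S_ne t
    have h2 := sqrt_ne ht
    have h3 := Real.sq_sqrt ht.le
    have h4 := S_sq t
    field_simp
    rw [h3]
    linear_combination 2 * h4
  · have := S_pos t
    rw [abs_of_nonneg (by positivity)]

theorem hInt_t_cube : hInt (fun t => t / S t ^ 3) = cc / 2 := by
  have h := hInt_eq_zero_of_hasDerivAt (G := fun t => √t * (1 - t / S t))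
    (g := fun t => (1 / 2) * (1 / (S t * (S t + t))) + (-1) * (t / S t ^ 3))
    ((HInt_w0.const_mul _).add (HInt_t_cube.const_mul _)) (fun t ht => ?_) (fun t ht => ?_)
  · rw [hInt_add (HInt_w0.const_mul _) (HInt_t_cube.const_mul _), hInt_const_mul,
      hInt_const_mul] at h
    change _ * cc + _ = 0 at h
    linarith
  · refine ((hasDerivAt_sqrt' ht).mul
      (((hasDerivAt_id t).div (hasDerivAt_S t) (S_ne t)).const_sub 1)).congr_deriv ?_
    rw [one_sub_div_S ht.le]
    have h1 := S_ne t
    have h2 := sqrt_ne ht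
    have h3 := Real.sq_sqrt ht.le
    have h4 := S_sq t
    simp only [id, Pi.div_apply]
    field_simp
    rw [h3]
    linear_combination (-2 * t) * h4
  · have := S_pos t
    rw [← one_sub_div_S ht, abs_of_nonneg (by positivity), mul_one_div]
    gcongr
    nlinarith [one_le_S t]

theorem hInt_t_five : hInt (fun t => t / S t ^ 5) = cc / 4 := by
  have h := hInt_eq_zero_of_hasDerivAt (G := fun t => √t * (t / S t ^ 3))
    (g := fun t => 3 * (t / S t ^ 5) + (-(3 / 2)) * (t / S t ^ 3))
    ((HInt_t_five.const_mul _).add (HInt_t_cube.const_mul _)) (fun t ht => ?_) (fun t ht => ?_)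
  · rw [hInt_add (HInt_t_five.const_mul _) (HInt_t_cube.const_mul _), hInt_const_mul,
      hInt_const_mul, hInt_t_cube] at h
    linarith
  · refine ((hasDerivAt_sqrt' ht).mul
      ((hasDerivAt_id t).div ((hasDerivAt_S t).pow 3) (pow_ne_zero 3 (S_ne t)))).congr_deriv ?_
    have h1 := S_ne t
    have h2 := sqrt_ne ht
    have h3 := Real.sq_sqrt ht.le
    have h4 := S_sq t
    simp only [id]
    field_simp
    rw [h3]
    norm_num
    field_simp
    linear_combination 6 * h4
  · have := S_pos t
    rw [abs_of_nonneg (by positivity), div_eq_mul_one_div (√t)]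
    have h2 : t / S t ^ 3 ≤ 1 / S t := by
      rw [div_le_div_iff₀ (by positivity) this]
      nlinarith [one_le_S t, mul_le_mul (one_le_S t) (le_S t) ht this.le]
    gcongr

theorem hInt_t_w0 : hInt (fun t => t / (S t * (S t + t))) = K / 3 := by
  have h := hInt_eq_zero_of_hasDerivAt
    (G := fun t => (-(2 / 3)) * (√t / (S t + t)))
    (g := fun t => t / (S t * (S t + t)) + (-(1 / 3)) * (1 / S t))
    (HInt_t_w0.add (hInt_one_div_S_exists.const_mul _)) (fun t ht => ?_) (fun t ht => ?_)
  · rw [hInt_add HInt_t_w0 (hInt_one_div_S_exists.const_mul _), hInt_const_mul] at h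
    change _ + _ * K = 0 at h
    linarith
  · have h1 := S_pos t
    refine (((hasDerivAt_sqrt' ht).div ((hasDerivAt_S t).add (hasDerivAt_id t))
      (by simp only [Pi.add_apply, id]; positivity)).const_mul (-(2 / 3))).congr_deriv ?_
    have h2 := sqrt_ne ht
    have h3 := Real.sq_sqrt ht.le
    simp only [id, Pi.add_apply]
    field_simp
    rw [h3]
    ring
  · have := S_pos t
    rw [abs_mul, abs_of_nonneg (a := √t / (S t + t)) (by positivity)]
    norm_num
    have h1 : √t / (S t + t) ≤ √t / S t := by gcongr; linarith
    have h2 : 0 ≤ √t / (S t + t) := by positivity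
    linarith

theorem hInt_w0_sq : hInt (fun t => 1 / (S t * (S t + t) ^ 2)) = K / 3 := by
  have h : ∀ t, 0 < t → 1 / (S t * (S t + t) ^ 2) =
      1 / S t + (-2) * (t / (S t * (S t + t))) := fun t ht => by
    have h1 := S_pos t
    have h4 := S_sq t
    field_simp
    linear_combination (-1) * h4
  rw [hInt_congr h, hInt_add hInt_one_div_S_exists (HInt_t_w0.const_mul _), hInt_const_mul,
    hInt_t_w0]
  change K + _ = _
  ring

/-! ### Numerical enclosures of `K` and `cc` -/

theorem hInt_split {g : ℝ → ℝ} (hg : HInt g) :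
    hInt g = (∫ t in Ioc (0 : ℝ) 1, g t / √t) + ∫ t in Ioi (1 : ℝ), g t / √t := by
  unfold hInt HInt at *
  rw [← Ioc_union_Ioi_eq_Ioi (zero_le_one (α := ℝ))] at hg ⊢
  exact setIntegral_union Ioc_disjoint_Ioi_same measurableSet_Ioi hg.left_of_union
    hg.right_of_union

/-- An upper bound for the integral of a function invariant under inversion, from a bound by a
trinomial on the unit interval. -/
theorem hInt_le_of_trinomial {g : ℝ → ℝ} (hg : HInt g)
    (hsym : ∀ t, 0 < t → g t = t⁻¹ * g t⁻¹) (a b c : ℝ) (i j k : ℕ)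
    (h : ∀ t, 0 < t → t ≤ 1 → g t ≤ a * t ^ i + b * t ^ j + c * t ^ k) :
    hInt g ≤ 2 * (a / (i + 1 / 2) + b / (j + 1 / 2) + c / (k + 1 / 2)) := by
  have h1 : (∫ t in Ioc (0 : ℝ) 1, g t / √t) ≤
      a / (i + 1 / 2) + b / (j + 1 / 2) + c / (k + 1 / 2) := by
    have hi := (integrableOn_Ioc_pow i).const_mul a
    have hj := (integrableOn_Ioc_pow j).const_mul b
    have hk := (integrableOn_Ioc_pow k).const_mul c
    calc (∫ t in Ioc (0 : ℝ) 1, g t / √t)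
        ≤ ∫ t in Ioc (0 : ℝ) 1, (a * (t ^ i / √t) + b * (t ^ j / √t) + c * (t ^ k / √t)) := by
          refine setIntegral_mono_on (hg.mono_set Ioc_subset_Ioi_self) ((hi.add hj).add hk)
            measurableSet_Ioc fun t ht => ?_
          have := h t ht.1 ht.2
          simp only [← mul_div_assoc, ← add_div]
          gcongr
      _ = _ := by
          have hij : IntegrableOn (fun t => a * (t ^ i / √t) + b * (t ^ j / √t)) (Ioc 0 1) :=
            hi.add hj
          rw [integral_add hij hk, integral_add hi hj]
          simp only [integral_const_mul, integral_Ioc_pow, mul_one_div]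
  have h2 : (∫ t in Ioi (1 : ℝ), g t / √t) ≤
      a / (i + 1 / 2) + b / (j + 1 / 2) + c / (k + 1 / 2) := by
    have hi := (integrableOn_Ioi_inv_pow (i + 1) (by omega)).const_mul a
    have hj := (integrableOn_Ioi_inv_pow (j + 1) (by omega)).const_mul b
    have hk := (integrableOn_Ioi_inv_pow (k + 1) (by omega)).const_mul c
    calc (∫ t in Ioi (1 : ℝ), g t / √t)
        ≤ ∫ t in Ioi (1 : ℝ), (a * (t⁻¹ ^ (i + 1) / √t) + b * (t⁻¹ ^ (j + 1) / √t)
            + c * (t⁻¹ ^ (k + 1) / √t)) := by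
          refine setIntegral_mono_on (hg.mono_set (Ioi_subset_Ioi zero_le_one))
            ((hi.add hj).add hk) measurableSet_Ioi fun t ht => ?_
          have ht0 : 0 < t := one_pos.trans ht
          -- The trinomial bound is used at t⁻¹. The integral of t^(-k-1)/√t over (1, ∞) equals that
          -- of t^k/√t over (0, 1), so both halves get the same bound.
          have := mul_le_mul_of_nonneg_left
            (h t⁻¹ (inv_pos.mpr ht0) (inv_le_one_of_one_le₀ (le_of_lt ht))) (inv_pos.mpr ht0).le
          rw [← hsym t ht0] at this
          simp only [← mul_div_assoc, ← add_div]
          gcongr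
          refine this.trans_eq ?_
          ring
      _ = _ := by
          have hij : IntegrableOn (fun t => a * (t⁻¹ ^ (i + 1) / √t) +
              b * (t⁻¹ ^ (j + 1) / √t)) (Ioi 1) := hi.add hj
          rw [integral_add hij hk, integral_add hi hj]
          simp only [integral_const_mul, integral_Ioi_inv_pow _ (Nat.le_add_left 1 _),
            mul_one_div]
          push_cast
          congr 3 <;> ring
  rw [hInt_split hg]
  linarith

theorem le_hInt_of_trinomial {g : ℝ → ℝ} (hg : HInt g)
    (hsym : ∀ t, 0 < t → g t = t⁻¹ * g t⁻¹) (a b c : ℝ) (i j k : ℕ)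
    (h : ∀ t, 0 < t → t ≤ 1 → a * t ^ i + b * t ^ j + c * t ^ k ≤ g t) :
    2 * (a / (i + 1 / 2) + b / (j + 1 / 2) + c / (k + 1 / 2)) ≤ hInt g := by
  have := hInt_le_of_trinomial (hg.const_mul (-1))
    (fun t ht => by rw [hsym t ht]; ring) (-a) (-b) (-c) i j k
    (fun t h1 h2 => by linarith [h t h1 h2])
  rw [hInt_const_mul, neg_div, neg_div, neg_div] at this
  linarith

theorem S_inv {t : ℝ} (ht : 0 < t) : S t⁻¹ = S t / t := by
  rw [S, S, ← Real.sqrt_sq ht.le, ← Real.sqrt_div (by positivity), Real.sqrt_sq ht.le]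
  congr 1
  field_simp
  ring

/-- With x = t², the Taylor polynomial 1 - x/2 + 3x²/8 lies above (1 + x)^(-1/2) on [0, 1]; stopping
one term earlier gives the lower bound. -/
theorem K_le : K ≤ 3.77 := by
  have h := hInt_le_of_trinomial hInt_one_div_S_exists (fun t ht => ?_) 1 (-(1 / 2)) (3 / 8) 0 2 4
    (fun t h0 h1 => ?_)
  · change K ≤ _ at h
    norm_num at h
    linarith
  · rw [S_inv ht]
    have := S_pos t
    field_simp
  · have hS := S_pos t
    rw [div_le_iff₀ hS]
    have h2 := S_sq t
    set x := t ^ 2 with hx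
    have hx0 : 0 < x := by positivity
    have hx1 : x ≤ 1 := pow_le_one₀ h0.le h1
    have e : (1 * t ^ 0 + -(1 / 2) * x + 3 / 8 * t ^ 4) = 1 - x / 2 + 3 / 8 * x ^ 2 := by
      rw [hx]; ring
    rw [e]
    have hp : 0 < 1 - x / 2 + 3 / 8 * x ^ 2 := by nlinarith
    refine (one_le_sq_iff₀ (by positivity)).mp ?_
    rw [mul_pow, h2]
    have hx3 : 0 ≤ x ^ 3 := by positivity
    nlinarith [mul_nonneg hx3 (sub_nonneg.mpr hx1), mul_nonneg hx3 hx0.le,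
      mul_nonneg hx3 (mul_nonneg hx0.le hx0.le)]

theorem le_K : 3.6 ≤ K := by
  have h := le_hInt_of_trinomial hInt_one_div_S_exists (fun t ht => ?_) 1 (-(1 / 2)) 0 0 2 4
    (fun t h0 h1 => ?_)
  · change _ ≤ K at h
    norm_num at h
    linarith
  · rw [S_inv ht]
    have := S_pos t
    field_simp
  · have hS := S_pos t
    rw [le_div_iff₀ hS]
    have h2 := S_sq t
    have hx1 : t ^ 2 ≤ 1 := pow_le_one₀ h0.le h1
    refine (sq_le_one_iff₀ (mul_nonneg (by nlinarith) hS.le)).mp ?_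
    rw [mul_pow, h2]
    nlinarith [sq_nonneg t, mul_nonneg (sq_nonneg t) (sq_nonneg (t ^ 2))]

/-- The integrand defining `cc` lacks this inversion symmetry, so `cc` is enclosed through t/S³,
whose integral is `cc`/2. -/
theorem t_cube_symm {t : ℝ} (ht : 0 < t) : t / S t ^ 3 = t⁻¹ * (t⁻¹ / S t⁻¹ ^ 3) := by
  rw [S_inv ht]
  have := S_pos t
  field_simp

theorem cc_le : cc ≤ 1.76 := by
  have h := hInt_le_of_trinomial HInt_t_cube (fun t ht => t_cube_symm ht) 1 (-1.1) (0.47) 1 3 5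
    (fun t h0 h1 => ?_)
  · rw [hInt_t_cube] at h
    norm_num at h
    linarith
  · have hS := S_pos t
    have h2 := S_sq t
    rw [div_le_iff₀ (by positivity)]
    set x := t ^ 2 with hx
    have hx0 : 0 < x := by positivity
    have hx1 : x ≤ 1 := pow_le_one₀ h0.le h1
    have e : 1 * t ^ 1 + -1.1 * t ^ 3 + 0.47 * t ^ 5 = t * (1 - 1.1 * x + 0.47 * x ^ 2) := by
      rw [hx]; ring
    have hp : 0 < 1 - 1.1 * x + 0.47 * x ^ 2 := by nlinarith [sq_nonneg (x - 1)]
    rw [e, mul_assoc]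
    -- What remains is a quadratic majorant of (1 + x)^(-3/2) on [0, 1], checked after squaring. Its
    -- coefficients are fitted numerically.
    refine le_mul_of_one_le_right h0.le ?_
    refine (one_le_sq_iff₀ (by positivity)).mp ?_
    have h3 : (S t ^ 3) ^ 2 = (1 + x) ^ 3 := by rw [← h2]; ring
    rw [mul_pow, h3]
    nlinarith [mul_nonneg hx0.le (sub_nonneg.mpr hx1), sq_nonneg (x - 8 / 10),
      mul_nonneg hx0.le (sq_nonneg (x - 8 / 10)),
      mul_nonneg (mul_nonneg hx0.le (sub_nonneg.mpr hx1)) (sq_nonneg (x - 8 / 10)),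
      mul_nonneg hx0.le (sq_nonneg (x * (x - 8 / 10))),
      mul_nonneg hx0.le (sq_nonneg (x * x * (x - 8 / 10)))]

theorem le_cc : 1.54 ≤ cc := by
  have h := le_hInt_of_trinomial HInt_t_cube (fun t ht => t_cube_symm ht) 0.81 (-0.54) 0 1 3 5
    (fun t h0 h1 => ?_)
  · rw [hInt_t_cube] at h
    norm_num at h
    linarith
  · have hS := S_pos t
    have h2 := S_sq t
    rw [le_div_iff₀ (by positivity)]
    set x := t ^ 2 with hx
    have hx0 : 0 < x := by positivity
    have hx1 : x ≤ 1 := pow_le_one₀ h0.le h1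
    have e : 0.81 * t ^ 1 + -0.54 * t ^ 3 + 0 * t ^ 5 = t * (0.81 - 0.54 * x) := by
      rw [hx]; ring
    have hp : 0 < 0.81 - 0.54 * x := by linarith
    rw [e, mul_assoc]
    refine mul_le_of_le_one_right h0.le ?_
    refine (sq_le_one_iff₀ (by positivity)).mp ?_
    have h3 : (S t ^ 3) ^ 2 = (1 + x) ^ 3 := by rw [← h2]; ring
    rw [mul_pow, h3]
    nlinarith [mul_nonneg hx0.le (sub_nonneg.mpr hx1), sq_nonneg (x - 1 / 2),
      mul_nonneg hx0.le (sq_nonneg (x - 1 / 2)),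
      mul_nonneg (sub_nonneg.mpr hx1) (sq_nonneg (x - 1 / 2)),
      mul_nonneg (mul_nonneg hx0.le (sub_nonneg.mpr hx1)) (sq_nonneg (x - 1 / 2)),
      sq_nonneg (x * (x - 1 / 2)), mul_nonneg hx0.le (sq_nonneg (x * (x - 1 / 2)))]

/-! ### The cubic of the Scherk end and the difference quotients -/

/-- `R σ t = √(t² - 2 σ t + 1)`. -/
def R (σ t : ℝ) : ℝ := √(t ^ 2 - 2 * σ * t + 1)

theorem R_arg_pos {σ : ℝ} (hσ : |σ| < 1) (t : ℝ) : 0 < t ^ 2 - 2 * σ * t + 1 := by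
  have := (sq_lt_one_iff_abs_lt_one σ).mpr hσ
  nlinarith [sq_nonneg (t - σ)]

theorem R_pos {σ : ℝ} (hσ : |σ| < 1) (t : ℝ) : 0 < R σ t := Real.sqrt_pos.mpr (R_arg_pos hσ t)

theorem R_sq {σ : ℝ} (hσ : |σ| < 1) (t : ℝ) : R σ t ^ 2 = t ^ 2 - 2 * σ * t + 1 :=
  Real.sq_sqrt (R_arg_pos hσ t).le

theorem R_inv {σ t : ℝ} (ht : 0 < t) : R σ t⁻¹ = R σ t / t := by
  rw [R, R, ← Real.sqrt_sq ht.le, ← Real.sqrt_div' _ (by positivity), Real.sqrt_sq ht.le]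
  congr 1
  field_simp
  ring

/-- The difference quotient of `(t + p) / R σ t`, up to a constant factor. -/
def W (α β k₁ k₂ σ p t : ℝ) : ℝ := (α + β * t) / (R σ t * (k₁ * R σ t + k₂ * (t + p)))

/-- The integrand of the numerators of the period conditions, up to a constant factor. -/
def V (ε σ b m t : ℝ) : ℝ := (1 - ε * t) / (R σ t * (t ^ 2 - 2 * b * t + m))

theorem f_eq {ρ σ t : ℝ} (hσ : Real.sin ρ = -σ) (ht : 0 ≤ t) : f ρ t = √t * R σ t := by
  rw [f, R, hσ, ← Real.sqrt_mul ht]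
  congr 1
  ring

theorem fTilde_eq {ρ σ t : ℝ} (hσ : Real.sin ρ = -σ) (ht : 0 ≤ t) :
    fTilde ρ t = √t * R (-σ) t := by
  rw [fTilde, R, hσ, ← Real.sqrt_mul ht]
  congr 1
  ring

/-- The data of the real cubic `w³ + 2σw² + w - r²(w + lam)²` with real root `p` and complex
roots `b ± ia`. -/
structure Cubic (σ lam r p a b : ℝ) : Prop where
  coeff_two : 2 * b + p - r ^ 2 = -2 * σ
  coeff_one : a ^ 2 + b ^ 2 + 2 * b * p + 2 * r ^ 2 * lam = 1
  coeff_zero : p * (a ^ 2 + b ^ 2) = r ^ 2 * lam ^ 2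

/-- The exponentials have product 1 and difference -2σi, so the numerator is -ix(x² + 2σix - 1). By
Vieta the cleared equation is -i times the product of the factors at the roots ip, a + ib, -a + ib.
Only one of these has positive real part. -/
theorem scherk_iff {ρ σ lam r p a b : ℝ} (hσ : Real.sin ρ = -σ) (h : Cubic σ lam r p a b)
    (x : ℂ) : IsScherkEnd ρ lam r x ↔ 0 < x.re ∧
      (x - p * Complex.I) * (x - (a + b * Complex.I)) * (x - (-a + b * Complex.I)) = 0 := by
  unfold IsScherkEnd
  refine and_congr_right fun hx => ?_
  have hden : x + lam * Complex.I ≠ 0 := fun h0 => by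
    have := congrArg Complex.re h0
    simp at this
    exact hx.ne' this
  have hexp : Complex.exp (Complex.I * ρ) - Complex.exp (-(Complex.I * ρ)) =
      -2 * σ * Complex.I := by
    have h1 : Complex.sin ρ = -(σ : ℂ) := by
      rw [← Complex.ofReal_sin, hσ, Complex.ofReal_neg]
    have h2 := Complex.two_sin (ρ : ℂ)
    rw [h1, neg_mul, mul_comm (ρ : ℂ)] at h2
    linear_combination (-Complex.I) * h2 + (Complex.exp (Complex.I * ρ) -
      Complex.exp (-(Complex.I * ρ))) * Complex.I_sq
  have hprod : Complex.exp (Complex.I * ρ) * Complex.exp (-(Complex.I * ρ)) = 1 := by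
    rw [← Complex.exp_add, add_neg_cancel, Complex.exp_zero]
  rw [div_eq_iff (pow_ne_zero 2 hden)]
  have e2 : (2 * b + p - r ^ 2 : ℂ) = -2 * σ := by exact_mod_cast h.coeff_two
  have e1 : (a ^ 2 + b ^ 2 + 2 * b * p + 2 * r ^ 2 * lam : ℂ) = 1 := by
    exact_mod_cast h.coeff_one
  have e0 : (p * (a ^ 2 + b ^ 2) : ℂ) = r ^ 2 * lam ^ 2 := by exact_mod_cast h.coeff_zero
  have key : -Complex.I * x * (x - Complex.exp (Complex.I * ρ)) *
      (x + Complex.exp (-(Complex.I * ρ))) - (r : ℂ) ^ 2 * (x + lam * Complex.I) ^ 2 =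
      -Complex.I * ((x - p * Complex.I) * (x - (a + b * Complex.I)) *
        (x - (-a + b * Complex.I))) := by
    have hI := Complex.I_sq
    have hI3 : Complex.I ^ 3 = -Complex.I := by rw [pow_succ, hI]; ring
    have hI4 : Complex.I ^ 4 = 1 := by rw [show 4 = 2 * 2 from rfl, pow_mul, hI]; ring
    have lhs : -Complex.I * x * (x - Complex.exp (Complex.I * ρ)) *
      (x + Complex.exp (-(Complex.I * ρ))) = -Complex.I * x * (x ^ 2 + 2 * σ * Complex.I * x - 1)
      := by
      linear_combination (Complex.I * x ^ 2) * hexp + (Complex.I * x) * hprod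
    rw [lhs]
    ring_nf
    simp only [hI, hI3, hI4]
    linear_combination x ^ 2 * e2 - Complex.I * x * e1 - e0
  constructor
  · intro h0
    rw [h0, sub_self] at key
    exact (mul_eq_zero.mp key.symm).resolve_left (neg_ne_zero.mpr Complex.I_ne_zero)
  · intro h0
    rw [h0, mul_zero] at key
    exact sub_eq_zero.mp key

theorem isScherkEnd_of_cubic {ρ σ lam r p a b : ℝ} (hσ : Real.sin ρ = -σ)
    (h : Cubic σ lam r p a b) (ha : 0 < a) :
    IsScherkEnd ρ lam r ⟨a, b⟩ ∧ ∀ x, IsScherkEnd ρ lam r x → x = ⟨a, b⟩ := by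
  have hab : ((a : ℂ) + b * Complex.I) = ⟨a, b⟩ := by apply Complex.ext <;> simp
  constructor
  · rw [scherk_iff hσ h, hab]
    exact ⟨ha, by simp⟩
  · intro x hx
    rw [scherk_iff hσ h] at hx
    obtain ⟨hre, hx⟩ := hx
    rcases mul_eq_zero.mp hx with hx | hx
    · rcases mul_eq_zero.mp hx with hx | hx
      · have := congrArg Complex.re hx
        simp at this
        exact absurd this hre.ne'
      · rw [← hab]
        exact sub_eq_zero.mp hx
    · have := congrArg Complex.re hx
      simp at this
      linarith

/-- This is the factored cubic at w = -t; the coefficients match by the Vieta relations. -/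
theorem f_sq_identity {σ lam r p a b : ℝ} (h : Cubic σ lam r p a b) (t : ℝ) :
    t * (t ^ 2 - 2 * σ * t + 1) =
      (t + p) * ((t + b) ^ 2 + a ^ 2) - r ^ 2 * (t - lam) ^ 2 := by
  linear_combination (-t ^ 2) * h.coeff_two - t * h.coeff_one - h.coeff_zero

/-- The coefficients of the numerator of `W`. -/
def alpha (σ ε p : ℝ) : ℝ := 1 - p ^ 2 + ε * (2 * p + 2 * σ * p ^ 2)

def beta (σ ε p : ℝ) : ℝ := ε * (1 - p ^ 2) - 2 * (σ + p)

/-- After rationalizing, the numerator (λ + p)²R(t)² - (t + p)²R(λ)² is quadratic in t and vanishes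
at t = λ. Its quotient by λ - t is λ(α + βt), so the singularity disappears. -/
theorem difference_quotient {σ lam p t : ℝ} (hσ : |σ| < 1) (hlam : 0 < lam) (hne : t ≠ lam)
    (hden : (1 + p * lam⁻¹) * R σ t + R σ lam⁻¹ * (t + p) ≠ 0) :
    ((lam + p) / R σ lam - (t + p) / R σ t) / (lam - t) =
      W (alpha σ lam⁻¹ p) (beta σ lam⁻¹ p) (1 + p * lam⁻¹) (R σ lam⁻¹) σ p t / R σ lam := by
  rw [R_inv hlam] at *
  have hX := R_pos hσ lam
  have hY := R_pos hσ t
  have hX2 := R_sq hσ lam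
  have hY2 := R_sq hσ t
  unfold W alpha beta
  generalize R σ lam = X at *
  generalize R σ t = Y at *
  have hsub : lam - t ≠ 0 := sub_ne_zero.mpr hne.symm
  have hden' : (lam + p) * Y + X * (t + p) ≠ 0 := by
    intro h0
    apply hden
    field_simp
    linear_combination h0
  have e : (1 + p * lam⁻¹) * Y + X / lam * (t + p) = ((lam + p) * Y + X * (t + p)) / lam := by
    field_simp
  rw [e]
  field_simp
  linear_combination (lam + p) ^ 2 * hY2 - (t + p) ^ 2 * hX2

/-- The previous identity at -t, with the other sign of the square root. -/
theorem difference_quotient_neg {σ lam p t : ℝ} (hσ : |σ| < 1) (hlam : 0 < lam)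
    (ht : 0 < t)
    (hden : (1 + p * lam⁻¹) * R (-σ) t + R σ lam⁻¹ * (t + -p) ≠ 0) :
    ((lam + p) / R σ lam - (t - p) / R (-σ) t) / (lam + t) =
      W (alpha σ lam⁻¹ p) (-beta σ lam⁻¹ p) (1 + p * lam⁻¹) (R σ lam⁻¹) (-σ) (-p) t /
        R σ lam := by
  rw [R_inv hlam] at *
  have hX := R_pos hσ lam
  have hY := R_pos (σ := -σ) (by rwa [abs_neg]) t
  have hX2 := R_sq hσ lam
  have hY2 := R_sq (σ := -σ) (by rwa [abs_neg]) t
  unfold W alpha beta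
  generalize R σ lam = X at *
  generalize R (-σ) t = Y at *
  have hden' : (lam + p) * Y + X * (t + -p) ≠ 0 := by
    intro h0
    apply hden
    field_simp
    linear_combination h0
  have e : (1 + p * lam⁻¹) * Y + X / lam * (t + -p) = ((lam + p) * Y + X * (t + -p)) / lam := by
    field_simp
  rw [e]
  field_simp
  linear_combination (lam + p) ^ 2 * hY2 - (t - p) ^ 2 * hX2

/-! ### Principal values and the two explicit kernels -/

theorem hasPVIntegral_congr {g h : ℝ → ℝ} {p v : ℝ} (hgh : ∀ t, 0 < t → t ≠ p → g t = h t)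
    (hg : HasPVIntegral g p v) : HasPVIntegral h p v := by
  have key : ∀ δ : ℝ, 0 < δ → EqOn g h (Ioi 0 \ Ioo (p - δ) (p + δ)) := fun δ hδ t ht => by
    refine hgh t ht.1 ?_
    rintro rfl
    exact ht.2 ⟨by linarith, by linarith⟩
  have hm : ∀ δ : ℝ, MeasurableSet (Ioi 0 \ Ioo (p - δ) (p + δ)) := fun δ =>
    measurableSet_Ioi.diff measurableSet_Ioo
  refine ⟨fun δ hδ => (hg.1 δ hδ).congr_fun (key δ hδ) (hm δ), ?_⟩
  refine hg.2.congr' ?_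
  filter_upwards [self_mem_nhdsWithin] with δ hδ
  exact setIntegral_congr_fun (hm δ) (key δ hδ)

theorem HasPVIntegral.const_mul {g : ℝ → ℝ} {p v : ℝ} (hg : HasPVIntegral g p v) (c : ℝ) :
    HasPVIntegral (fun t => c * g t) p (c * v) := by
  refine ⟨fun δ hδ => Integrable.const_mul (hg.1 δ hδ) c, ?_⟩
  simp only [integral_const_mul]
  exact hg.2.const_mul c

theorem HasPVIntegral.add {g h : ℝ → ℝ} {p v w : ℝ} (hg : HasPVIntegral g p v)
    (hh : HasPVIntegral h p w) : HasPVIntegral (fun t => g t + h t) p (v + w) := by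
  refine ⟨fun δ hδ => Integrable.add (hg.1 δ hδ) (hh.1 δ hδ), ?_⟩
  refine (hg.2.add hh.2).congr' ?_
  filter_upwards [self_mem_nhdsWithin] with δ hδ
  exact (integral_add (hg.1 δ hδ) (hh.1 δ hδ)).symm

/-- An integrable function has its integral as principal value. -/
theorem hasPVIntegral_of_integrableOn {g : ℝ → ℝ} (p : ℝ) (hg : IntegrableOn g (Ioi 0)) :
    HasPVIntegral g p (∫ t in Ioi 0, g t) := by
  refine ⟨fun δ _ => hg.mono_set sdiff_subset, ?_⟩
  have hm : ∀ δ : ℝ, MeasurableSet (Ioo (p - δ) (p + δ)) := fun δ => measurableSet_Ioo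
  have e : ∀ δ : ℝ, ∫ t in Ioi 0 \ Ioo (p - δ) (p + δ), g t =
      ∫ t in Ioi 0, (Ioo (p - δ) (p + δ))ᶜ.indicator g t := fun δ => by
    rw [setIntegral_indicator (hm δ).compl, sdiff_eq]
  simp only [e]
  refine tendsto_integral_filter_of_dominated_convergence (fun t => ‖g t‖) ?_ ?_ hg.norm ?_
  · exact Eventually.of_forall fun δ => hg.aestronglyMeasurable.indicator (hm δ).compl
  · exact Eventually.of_forall fun δ => ae_of_all _ fun t => norm_indicator_le_norm_self _ _
  · have hne : ∀ᵐ t ∂(volume.restrict (Ioi (0 : ℝ))), t ≠ p :=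
      ae_restrict_of_ae (Measure.ae_ne volume p)
    filter_upwards [hne] with t ht
    refine tendsto_const_nhds.congr' ?_
    have hpos : 0 < |t - p| := abs_pos.mpr (sub_ne_zero.mpr ht)
    filter_upwards [Ioo_mem_nhdsGT hpos] with δ hδ
    rw [indicator_of_mem]
    intro h
    have : |t - p| < δ := abs_lt.mpr ⟨by linarith [h.1], by linarith [h.2]⟩
    linarith [hδ.2]

/-- A primitive of `1 / (√t (t - p))`. -/
def pvPrim (p t : ℝ) : ℝ := (√p)⁻¹ * Real.log ((√t - √p) / (√t + √p))

theorem hasDerivAt_pvPrim {p t : ℝ} (hp : 0 < p) (ht : 0 < t) (hne : t ≠ p) :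
    HasDerivAt (pvPrim p) (1 / (t - p) / √t) t := by
  have hsp := Real.sqrt_pos.mpr hp
  have hst := Real.sqrt_pos.mpr ht
  have hsub : √t - √p ≠ 0 := fun h => hne ((Real.sqrt_inj ht.le hp.le).mp (sub_eq_zero.mp h))
  have hsub2 : t - p ≠ 0 := sub_ne_zero.mpr hne
  have h1 := ((hasDerivAt_sqrt' ht).sub_const (√p)).div ((hasDerivAt_sqrt' ht).add_const (√p))
    (by positivity)
  have h2 := (h1.log (div_ne_zero hsub (by positivity))).const_mul (√p)⁻¹
  refine h2.congr_deriv ?_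
  have e : t - p = (√t - √p) * (√t + √p) := by
    nlinarith [Real.sq_sqrt ht.le, Real.sq_sqrt hp.le]
  simp only [Pi.div_apply]
  rw [e]
  field_simp
  ring

theorem pv_kernel_integrableOn {p δ : ℝ} (hp : 0 < p) (hδ : 0 < δ) :
    IntegrableOn (fun t => 1 / (t - p) / √t) (Ioi 0 \ Ioo (p - δ) (p + δ)) := by
  have hm : MeasurableSet (Ioi 0 \ Ioo (p - δ) (p + δ)) :=
    measurableSet_Ioi.diff measurableSet_Ioo
  have hb : IntegrableOn (fun t => (1 + (p + 1) / δ) * (1 / S t / √t))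
      (Ioi 0 \ Ioo (p - δ) (p + δ)) :=
    Integrable.mono_measure (Integrable.const_mul hInt_one_div_S_exists _)
      (Measure.restrict_mono sdiff_subset le_rfl)
  refine Integrable.mono' hb ?_ ?_
  · have : Measurable (fun t : ℝ => 1 / (t - p) / √t) := by fun_prop
    exact this.aestronglyMeasurable
  · refine (ae_restrict_iff' hm).mpr (ae_of_all _ fun t ht => ?_)
    have ht0 : 0 < t := ht.1
    have hd : δ ≤ |t - p| := by
      by_contra! h
      rw [abs_lt] at h
      exact ht.2 ⟨by linarith, by linarith⟩
    have hS := S_pos t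
    have hpos : 0 < |t - p| := hδ.trans_le hd
    rw [norm_div, norm_div, norm_one, Real.norm_eq_abs, Real.norm_of_nonneg (Real.sqrt_nonneg t),
      ← mul_div_assoc]
    have h1 : 1 / |t - p| ≤ (1 + (p + 1) / δ) * (1 / S t) := by
      rw [mul_one_div, div_le_div_iff₀ hpos hS, one_mul]
      have h2 := S_le ht0.le
      have h3 : t - p ≤ |t - p| := le_abs_self _
      have h4 : p + 1 ≤ (p + 1) / δ * |t - p| := by
        rw [div_mul_eq_mul_div, le_div_iff₀ hδ]
        gcongr
      linarith
    gcongr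

theorem tendsto_pvPrim_atTop (p : ℝ) : Tendsto (pvPrim p) atTop (𝓝 0) := by
  have h1 : Tendsto (fun t : ℝ => 2 * √p / (√t + √p)) atTop (𝓝 0) :=
    (tendsto_atTop_add_const_right _ _ Real.tendsto_sqrt_atTop).const_div_atTop _
  have h2 : Tendsto (fun t : ℝ => (√t - √p) / (√t + √p)) atTop (𝓝 1) := by
    have := h1.const_sub 1
    rw [sub_zero] at this
    refine this.congr' ?_
    filter_upwards [eventually_gt_atTop 0] with t ht
    have := Real.sqrt_pos.mpr ht
    field_simp
    ring
  have h3 := ((Real.continuousAt_log one_ne_zero).tendsto.comp h2).const_mul (√p)⁻¹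
  rw [Real.log_one, mul_zero] at h3
  exact h3

/-- The principal value of the integral of `1 / (√t (t - p))` is zero. -/
theorem hasPVIntegral_kernel {p : ℝ} (hp : 0 < p) :
    HasPVIntegral (fun t => 1 / (t - p) / √t) p 0 := by
  refine ⟨fun δ hδ => pv_kernel_integrableOn hp hδ, ?_⟩
  have hsp := Real.sqrt_pos.mpr hp
  have hval : ∀ δ ∈ Ioo 0 p, ∫ t in Ioi 0 \ Ioo (p - δ) (p + δ), 1 / (t - p) / √t =
      pvPrim p (p - δ) - pvPrim p (p + δ) := fun δ hδ => by
    have hset : Ioi 0 \ Ioo (p - δ) (p + δ) = Ioc 0 (p - δ) ∪ Ici (p + δ) := by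
      ext t
      simp only [Set.mem_sdiff, mem_Ioi, mem_Ioo, mem_union, mem_Ioc, mem_Ici, not_and, not_lt]
      constructor
      · rintro ⟨h0, h1⟩
        rcases le_or_gt t (p - δ) with h | h
        · exact Or.inl ⟨h0, h⟩
        · exact Or.inr (h1 h)
      · rintro (⟨h0, h1⟩ | h)
        · exact ⟨h0, fun h2 => absurd h1 (not_le.mpr h2)⟩
        · exact ⟨by linarith [hδ.1], fun _ => h⟩
    have hi := pv_kernel_integrableOn hp hδ.1
    rw [hset] at hi ⊢
    have hdisj : Disjoint (Ioc 0 (p - δ)) (Ici (p + δ)) := by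
      rw [Set.disjoint_left]
      intro t h1 h2
      linarith [h1.2, mem_Ici.mp h2, hδ.1]
    rw [setIntegral_union hdisj measurableSet_Ici hi.left_of_union hi.right_of_union]
    have hpd : 0 ≤ p - δ := by linarith [hδ.2]
    have i1 : ∫ t in Ioc 0 (p - δ), 1 / (t - p) / √t = pvPrim p (p - δ) := by
      rw [← intervalIntegral.integral_of_le hpd]
      rw [intervalIntegral.integral_eq_sub_of_hasDerivAt_of_le hpd (f := pvPrim p)]
      -- At t = 0 the argument of the logarithm is -1, and `Real.log (-1) = 0`; the real logarithm
      -- is log|·| throughout.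
      · simp [pvPrim, neg_div, div_self hsp.ne']
      · intro t ht
        have h1 : √t < √p := Real.sqrt_lt_sqrt ht.1 (by linarith [ht.2, hδ.1])
        have h2 := Real.sqrt_nonneg t
        refine ContinuousAt.continuousWithinAt ?_
        unfold pvPrim
        refine continuousAt_const.mul (ContinuousAt.log ?_ ?_)
        · exact (Real.continuous_sqrt.continuousAt.sub continuousAt_const).div
            (Real.continuous_sqrt.continuousAt.add continuousAt_const) (by positivity)
        · exact div_ne_zero (by linarith) (by positivity)
      · intro t ht
        exact hasDerivAt_pvPrim hp ht.1 (by linarith [ht.2, hδ.1])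
      · rw [intervalIntegrable_iff_integrableOn_Ioc_of_le hpd]
        exact hi.left_of_union
    have i2 : ∫ t in Ici (p + δ), 1 / (t - p) / √t = -pvPrim p (p + δ) := by
      rw [integral_Ici_eq_integral_Ioi]
      rw [integral_Ioi_of_hasDerivAt_of_tendsto' (f := pvPrim p) (m := 0)]
      · ring
      · intro t ht
        have : p + δ ≤ t := ht
        exact hasDerivAt_pvPrim hp (by linarith [hδ.1]) (by linarith [hδ.1])
      · exact hi.right_of_union.mono_set Ioi_subset_Ici_self
      · exact tendsto_pvPrim_atTop p
    rw [i1, i2]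
    ring
  -- The two divergent terms log δ cancel, leaving an expression continuous at δ = 0 with value 0.
  have hclosed : ∀ δ ∈ Ioo 0 p, pvPrim p (p - δ) - pvPrim p (p + δ) =
      (√p)⁻¹ * (2 * Real.log ((√(p + δ) + √p) / (√(p - δ) + √p))) := fun δ hδ => by
    have h1 : 0 < p - δ := by linarith [hδ.2]
    have h2 : 0 < p + δ := by linarith [hδ.1]
    have hδ0 := hδ.1
    have s1 := Real.sqrt_pos.mpr h1
    have s2 := Real.sqrt_pos.mpr h2
    have q1 := Real.sq_sqrt h1.le
    have q2 := Real.sq_sqrt h2.le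
    have q := Real.sq_sqrt hp.le
    have e1 : (√(p - δ) - √p) / (√(p - δ) + √p) = -(δ / (√(p - δ) + √p) ^ 2) := by
      field_simp
      linear_combination q1 - q
    have e2 : (√(p + δ) - √p) / (√(p + δ) + √p) = δ / (√(p + δ) + √p) ^ 2 := by
      field_simp
      linear_combination q2 - q
    unfold pvPrim
    rw [e1, e2, Real.log_neg_eq_log, ← mul_sub, Real.log_div hδ0.ne' (by positivity),
      Real.log_div hδ0.ne' (by positivity), Real.log_div (by positivity) (by positivity),
      Real.log_pow, Real.log_pow]
    push_cast
    ring
  have hlim : Tendsto (fun δ : ℝ =>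
      (√p)⁻¹ * (2 * Real.log ((√(p + δ) + √p) / (√(p - δ) + √p)))) (𝓝[>] 0) (𝓝 0) := by
    have hc : ContinuousAt (fun δ : ℝ =>
        (√p)⁻¹ * (2 * Real.log ((√(p + δ) + √p) / (√(p - δ) + √p)))) 0 := by
      refine continuousAt_const.mul (continuousAt_const.mul (ContinuousAt.log ?_ ?_))
      · refine ContinuousAt.div (by fun_prop) (by fun_prop) ?_
        simp only [sub_zero]
        positivity
      · simp only [sub_zero, add_zero]
        positivity
    have h0 := hc.tendsto.mono_left (nhdsWithin_le_nhds (s := Ioi 0))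
    simpa [div_self (add_pos hsp hsp).ne'] using h0
  refine hlim.congr' ?_
  filter_upwards [Ioo_mem_nhdsGT hp] with δ hδ
  rw [hval δ hδ, hclosed δ hδ]

/-- The primitive is an arctangent of √t/√p. This kernel accounts for the π-term in the denominator
of c₃. -/
theorem hInt_kernel_pos {p : ℝ} (hp : 0 < p) :
    HInt (fun t => 1 / (t + p)) ∧ hInt (fun t => 1 / (t + p)) = Real.pi / √p := by
  have hsp := Real.sqrt_pos.mpr hp
  have hi : HInt (fun t => 1 / (t + p)) := by
    refine HInt.of_bound (C := 1 + 1 / p) ?_ fun t ht => ?_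
    · refine continuousOn_const.div (by fun_prop) fun t ht => ?_
      have : 0 < t := ht
      positivity
    · have hS := S_pos t
      rw [abs_of_pos (by positivity), div_le_div_iff₀ (by positivity) hS]
      have h2 := S_le ht.le
      have : 0 < t / p := by positivity
      have e : (1 + 1 / p) * (t + p) = t + p + t / p + 1 := by field_simp; ring
      rw [e]
      linarith
  refine ⟨hi, ?_⟩
  unfold hInt
  rw [integral_Ioi_of_hasDerivAt_of_tendsto
    (f := fun t => 2 / √p * Real.arctan (√t / √p)) (m := 2 / √p * (Real.pi / 2)) ?_ ?_ hi ?_]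
  · simp
  · have : Continuous (fun t => 2 / √p * Real.arctan (√t / √p)) :=
      continuous_const.mul (Real.continuous_arctan.comp (Real.continuous_sqrt.div_const _))
    exact this.continuousWithinAt
  · intro t ht
    have ht0 : 0 < t := ht
    refine (((hasDerivAt_sqrt' ht0).div_const (√p)).arctan.const_mul (2 / √p)).congr_deriv ?_
    have h1 := Real.sq_sqrt ht0.le
    have h2 := Real.sq_sqrt hp.le
    have h3 := Real.sqrt_pos.mpr ht0
    have h4 : 1 + (√t / √p) ^ 2 = (t + p) / p := by
      rw [div_pow, h1, h2]
      field_simp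
      ring
    rw [h4]
    field_simp
    rw [h2]
  · refine Tendsto.const_mul _ ?_
    have h1 : Tendsto (fun t : ℝ => √t / √p) atTop atTop :=
      Real.tendsto_sqrt_atTop.atTop_div_const hsp
    exact (Real.tendsto_arctan_atTop.mono_right nhdsWithin_le_nhds).comp h1

/-! ### Reduction of the period conditions -/

variable {ρ σ lam r p a b : ℝ}

theorem integrandI1_eq (hσ : Real.sin ρ = -σ) (hlam : 0 < lam) {t : ℝ} (ht : 0 < t) :
    integrandI1 ρ lam a b t = lam * V lam⁻¹ σ (-b) (a ^ 2 + b ^ 2) t / √t := by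
  unfold integrandI1 V
  rw [f_eq hσ ht.le]
  have e : (t + b) ^ 2 + a ^ 2 = t ^ 2 - 2 * -b * t + (a ^ 2 + b ^ 2) := by ring
  have e2 : lam - t = lam * (1 - lam⁻¹ * t) := by field_simp
  rw [e, e2, mul_div_assoc', div_div]
  congr 1
  ring

theorem integrandJ1_eq (hσ : Real.sin ρ = -σ) (hlam : 0 < lam) {t : ℝ} (ht : 0 < t) :
    integrandJ1 ρ lam a b t = lam * V (-lam⁻¹) (-σ) b (a ^ 2 + b ^ 2) t / √t := by
  unfold integrandJ1 V
  rw [fTilde_eq hσ ht.le]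
  have e : (t - b) ^ 2 + a ^ 2 = t ^ 2 - 2 * b * t + (a ^ 2 + b ^ 2) := by ring
  have e2 : t + lam = lam * (1 - -lam⁻¹ * t) := by field_simp; ring
  rw [e, e2, mul_div_assoc', div_div]
  congr 1
  ring

/-- Reduction of the third period integral. -/
theorem integrandJ2_eq (hσ : Real.sin ρ = -σ) (hσ1 : |σ| < 1) (hlam : 0 < lam) (ha : 0 < a)
    (h : Cubic σ lam r p a b) {t : ℝ} (ht : 0 < t)
    (hden : (1 + p * lam⁻¹) * R (-σ) t + R σ lam⁻¹ * (t + -p) ≠ 0) :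
    integrandJ2 ρ lam a b t =
      ((lam + p) / R σ lam * (1 / (t + lam)) + (-(R σ lam)⁻¹) *
        W (alpha σ lam⁻¹ p) (-beta σ lam⁻¹ p) (1 + p * lam⁻¹) (R σ lam⁻¹) (-σ) (-p) t +
        r ^ 2 * lam * V (-lam⁻¹) (-σ) b (a ^ 2 + b ^ 2) t) / √t := by
  have hdq := difference_quotient_neg hσ1 hlam ht hden
  have hJ := integrandJ1_eq (a := a) (b := b) hσ hlam ht
  have hst := Real.sqrt_pos.mpr ht
  have hY := R_pos (σ := -σ) (by rwa [abs_neg]) t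
  have hY2 := R_sq (σ := -σ) (by rwa [abs_neg]) t
  -- At -t the identity reads f̃(t)² = (t - p)((t - b)² + a²) + r²(t + λ)², which splits off r²
  -- times `integrandJ1`.
  have hid := f_sq_identity h (-t)
  have hs := Real.sq_sqrt ht.le
  have e1 : (-(R σ lam)⁻¹) *
      W (alpha σ lam⁻¹ p) (-beta σ lam⁻¹ p) (1 + p * lam⁻¹) (R σ lam⁻¹) (-σ) (-p) t =
      -(((lam + p) / R σ lam - (t - p) / R (-σ) t) / (lam + t)) := by
    rw [hdq]
    ring
  have e2 : r ^ 2 * lam * V (-lam⁻¹) (-σ) b (a ^ 2 + b ^ 2) t / √t =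
      r ^ 2 * integrandJ1 ρ lam a b t := by
    rw [hJ]
    ring
  rw [add_div, e1, e2]
  unfold integrandJ1 integrandJ2
  rw [fTilde_eq hσ ht.le]
  have hQ : 0 < (t - b) ^ 2 + a ^ 2 := by positivity
  have hl : 0 < t + lam := by positivity
  have hl' : lam + t ≠ 0 := by positivity
  have e3 : ((lam + p) / R σ lam * (1 / (t + lam)) +
      -(((lam + p) / R σ lam - (t - p) / R (-σ) t) / (lam + t))) / √t =
      (t - p) / R (-σ) t / (t + lam) / √t := by
    rw [add_comm lam t]
    ring
  rw [e3]
  generalize R (-σ) t = Y at *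
  generalize √t = s at *
  field_simp
  subst hs
  linear_combination s ^ 2 * hY2 - hid

/-- Reduction of the second period integral. -/
theorem integrandI2_eq (hσ : Real.sin ρ = -σ) (hσ1 : |σ| < 1) (hlam : 0 < lam) (ha : 0 < a)
    (h : Cubic σ lam r p a b) {t : ℝ} (ht : 0 < t) (hne : t ≠ lam)
    (hden : (1 + p * lam⁻¹) * R σ t + R σ lam⁻¹ * (t + p) ≠ 0) :
    integrandI2 ρ lam a b t =
      (lam + p) / R σ lam * (1 / (t - lam) / √t) + ((R σ lam)⁻¹ *
        W (alpha σ lam⁻¹ p) (beta σ lam⁻¹ p) (1 + p * lam⁻¹) (R σ lam⁻¹) σ p t +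
        r ^ 2 * lam * V lam⁻¹ σ (-b) (a ^ 2 + b ^ 2) t) / √t := by
  have hdq := difference_quotient hσ1 hlam hne hden
  have hJ := integrandI1_eq (a := a) (b := b) hσ hlam ht
  have hst := Real.sqrt_pos.mpr ht
  have hY := R_pos hσ1 t
  have hX := R_pos hσ1 lam
  have hY2 := R_sq hσ1 t
  have hid := f_sq_identity h t
  have hs := Real.sq_sqrt ht.le
  have hsub : t - lam ≠ 0 := sub_ne_zero.mpr hne
  have hsub' : lam - t ≠ 0 := sub_ne_zero.mpr hne.symm
  have e1 : (R σ lam)⁻¹ *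
      W (alpha σ lam⁻¹ p) (beta σ lam⁻¹ p) (1 + p * lam⁻¹) (R σ lam⁻¹) σ p t =
      ((lam + p) / R σ lam - (t + p) / R σ t) / (lam - t) := by
    rw [hdq]
    ring
  have e2 : r ^ 2 * lam * V lam⁻¹ σ (-b) (a ^ 2 + b ^ 2) t / √t =
      r ^ 2 * integrandI1 ρ lam a b t := by
    rw [hJ]
    ring
  rw [e1, add_div _ _ (√t), e2]
  unfold integrandI1 integrandI2
  rw [f_eq hσ ht.le]
  have hQ : 0 < (t + b) ^ 2 + a ^ 2 := by positivity
  have e3 : (lam + p) / R σ lam * (1 / (t - lam) / √t) +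
      (((lam + p) / R σ lam - (t + p) / R σ t) / (lam - t)) / √t =
      (t + p) / R σ t / (t - lam) / √t := by
    rw [← neg_sub t lam]
    generalize t - lam = d at *
    field_simp
    ring
  rw [← add_assoc, e3]
  generalize R σ t = Y at *
  generalize √t = s at *
  field_simp
  subst hs
  linear_combination s ^ 2 * hY2 + hid

/-- The three values of `c²` agree if the reduced period equations hold. -/
theorem periods_of_reduced (hσ : Real.sin ρ = -σ) (hσ1 : |σ| < 1) (hlam : 0 < lam)
    (hr : 0 < r) (hp : 0 < p) (ha : 0 < a) (h : Cubic σ lam r p a b)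
    (hdenA : ∀ t, 0 < t → (1 + p * lam⁻¹) * R σ t + R σ lam⁻¹ * (t + p) ≠ 0)
    (hdenE : ∀ t, 0 < t → (1 + p * lam⁻¹) * R (-σ) t + R σ lam⁻¹ * (t + -p) ≠ 0)
    (hWA : HInt (W (alpha σ lam⁻¹ p) (beta σ lam⁻¹ p) (1 + p * lam⁻¹) (R σ lam⁻¹) σ p))
    (hWE : HInt (W (alpha σ lam⁻¹ p) (-beta σ lam⁻¹ p) (1 + p * lam⁻¹) (R σ lam⁻¹) (-σ) (-p)))
    (hVI : HInt (V lam⁻¹ σ (-b) (a ^ 2 + b ^ 2)))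
    (hVJ : HInt (V (-lam⁻¹) (-σ) b (a ^ 2 + b ^ 2)))
    (hI : hInt (V lam⁻¹ σ (-b) (a ^ 2 + b ^ 2)) ≠ 0)
    (hJ : hInt (V (-lam⁻¹) (-σ) b (a ^ 2 + b ^ 2)) ≠ 0)
    (hC : 0 < 2 * a * r * ((lam + p) / f ρ lam) - r ^ 2)
    (hE : hInt (W (alpha σ lam⁻¹ p) (-beta σ lam⁻¹ p) (1 + p * lam⁻¹) (R σ lam⁻¹) (-σ) (-p)) /
      R σ lam = 2 * a * r * ((lam + p) / f ρ lam) *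
        (lam * hInt (V (-lam⁻¹) (-σ) b (a ^ 2 + b ^ 2))))
    (hA : hInt (W (alpha σ lam⁻¹ p) (beta σ lam⁻¹ p) (1 + p * lam⁻¹) (R σ lam⁻¹) σ p) /
      R σ lam = (2 * a * r * ((lam + p) / f ρ lam) - 2 * r ^ 2) *
        (lam * hInt (V lam⁻¹ σ (-b) (a ^ 2 + b ^ 2)))) :
    2 * a * f ρ lam * r - r ^ 2 * ((lam + b) ^ 2 + a ^ 2) ≠ 0 ∧
      ∃ C : ℝ, 0 < C ∧ C = c1 ρ lam r a b ∧ IsC2 ρ lam a b C ∧ IsC3 ρ lam a b C := by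
  have hX := R_pos hσ1 lam
  have hfl := f_eq hσ hlam.le
  have hsl := Real.sqrt_pos.mpr hlam
  have hfpos : 0 < f ρ lam := by rw [hfl]; positivity
  have hD : 0 < (lam + b) ^ 2 + a ^ 2 := by positivity
  have hfsq : f ρ lam ^ 2 = (lam + p) * ((lam + b) ^ 2 + a ^ 2) := by
    rw [hfl, mul_pow, Real.sq_sqrt hlam.le, R_sq hσ1, f_sq_identity h lam]
    ring
  -- At t = λ the r²-term of `f_sq_identity` drops out, hence two expressions for H.
  have hh : (lam + p) / f ρ lam = f ρ lam / ((lam + b) ^ 2 + a ^ 2) := by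
    rw [div_eq_div_iff hfpos.ne' hD.ne', ← hfsq, sq]
  have hI1 : ∫ t in Ioi 0, integrandI1 ρ lam a b t =
      lam * hInt (V lam⁻¹ σ (-b) (a ^ 2 + b ^ 2)) := by
    rw [← hInt_const_mul]
    exact setIntegral_congr_fun measurableSet_Ioi fun t ht => integrandI1_eq hσ hlam ht
  have hJ1 : ∫ t in Ioi 0, integrandJ1 ρ lam a b t =
      lam * hInt (V (-lam⁻¹) (-σ) b (a ^ 2 + b ^ 2)) := by
    rw [← hInt_const_mul]
    exact setIntegral_congr_fun measurableSet_Ioi fun t ht => integrandJ1_eq hσ hlam ht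
  set H := (lam + p) / f ρ lam with hH
  set i := hInt (V lam⁻¹ σ (-b) (a ^ 2 + b ^ 2)) with hi_def
  set j := hInt (V (-lam⁻¹) (-σ) b (a ^ 2 + b ^ 2)) with hj_def
  set Q := 2 * a * r * H - r ^ 2 with hQ
  have hcc : 2 * a * f ρ lam * r - r ^ 2 * ((lam + b) ^ 2 + a ^ 2) =
      ((lam + b) ^ 2 + a ^ 2) * Q := by
    rw [hQ, hh]
    field_simp
  -- The common value is 1/Q: both period denominators turn out to be Q times their numerators.
  refine ⟨by rw [hcc]; positivity, 1 / Q, by positivity, ?_, ⟨?_, ?_⟩, ?_⟩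
  · rw [c1, hcc]
    field_simp
  · exact (hVI.const_mul lam).congr_fun (fun t ht => (integrandI1_eq hσ hlam ht).symm)
      measurableSet_Ioi
  · refine ⟨Q * (lam * i), ?_, by positivity, ?_⟩
    · have h1 := (hWA.const_mul (R σ lam)⁻¹).add (hVI.const_mul (r ^ 2 * lam))
      have h2 := ((hasPVIntegral_kernel hlam).const_mul ((lam + p) / R σ lam)).add
        (hasPVIntegral_of_integrableOn lam h1)
      have e : (lam + p) / R σ lam * 0 + ∫ t in Ioi 0, ((R σ lam)⁻¹ *
          W (alpha σ lam⁻¹ p) (beta σ lam⁻¹ p) (1 + p * lam⁻¹) (R σ lam⁻¹) σ p t +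
          r ^ 2 * lam * V lam⁻¹ σ (-b) (a ^ 2 + b ^ 2) t) / √t = Q * (lam * i) := by
        rw [mul_zero, zero_add]
        have e2 := hInt_add (hWA.const_mul (R σ lam)⁻¹) (hVI.const_mul (r ^ 2 * lam))
        rw [hInt_const_mul, hInt_const_mul] at e2
        refine e2.trans ?_
        rw [inv_mul_eq_div, hA, hQ]
        ring
      rw [e] at h2
      exact hasPVIntegral_congr
        (fun t ht hne => (integrandI2_eq hσ hσ1 hlam ha h ht hne (hdenA t ht)).symm) h2
    · rw [hI1]
      field_simp
  · have hker := hInt_kernel_pos hlam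
    have h1 := (hker.1.const_mul ((lam + p) / R σ lam)).add (hWE.const_mul (-(R σ lam)⁻¹))
    have h2 := h1.add (hVJ.const_mul (r ^ 2 * lam))
    have hcongr : ∀ t ∈ Ioi (0 : ℝ), _ = integrandJ2 ρ lam a b t := fun t ht =>
      (integrandJ2_eq hσ hσ1 hlam ha h ht (hdenE t ht)).symm
    have hJ2 : ∫ t in Ioi 0, integrandJ2 ρ lam a b t =
        (lam + p) / R σ lam * (Real.pi / √lam) - 2 * a * r * H * (lam * j) +
          r ^ 2 * (lam * j) := by
      rw [← setIntegral_congr_fun measurableSet_Ioi hcongr]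
      have e2 := hInt_add h1 (hVJ.const_mul (r ^ 2 * lam))
      rw [hInt_add (hker.1.const_mul _) (hWE.const_mul _), hInt_const_mul, hInt_const_mul,
        hInt_const_mul, hker.2] at e2
      refine e2.trans ?_
      rw [← hE]
      ring
    have hden : Real.pi * f ρ lam / ((lam + b) ^ 2 + a ^ 2) -
        ∫ t in Ioi 0, integrandJ2 ρ lam a b t = Q * (lam * j) := by
      have e3 : Real.pi * f ρ lam / ((lam + b) ^ 2 + a ^ 2) =
          (lam + p) / R σ lam * (Real.pi / √lam) := by
        rw [mul_div_assoc, ← hh, hH, hfl]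
        field_simp
      rw [hJ2, e3, hQ]
      ring
    refine ⟨?_, IntegrableOn.congr_fun h2 hcongr measurableSet_Ioi, ?_, ?_⟩
    · exact (hVJ.const_mul lam).congr_fun (fun t ht => (integrandJ1_eq hσ hlam ht).symm)
        measurableSet_Ioi
    · rw [hden]
      positivity
    · rw [hden, hJ1]
      field_simp

/-! ### Explicit parametrization by σ, ε = 1/λ and p -/

/-- `|x|²` for the Scherk end `x` of parameters `(σ, 1/ε, p)`. -/
def mm (σ ε p : ℝ) : ℝ := (1 + 2 * σ * p + p ^ 2) / (1 + p * ε) ^ 2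

/-- Minus the imaginary part of the Scherk end. -/
def bb (σ ε p : ℝ) : ℝ := (2 * σ + p - p * ε ^ 2 * mm σ ε p) / 2

/-- The real part of the Scherk end. -/
def aa (σ ε p : ℝ) : ℝ := √(mm σ ε p - bb σ ε p ^ 2)

/-- `WA` and `WE` are the regular parts of the denominators of c₂ and c₃; `VI` and `VJ` come from
the numerators. At σ = ε = p = 0 each pair coincides. -/
def WA (σ ε p : ℝ) : ℝ → ℝ :=
  W (alpha σ ε p) (beta σ ε p) (1 + p * ε) (R σ ε) σ p

def WE (σ ε p : ℝ) : ℝ → ℝ :=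
  W (alpha σ ε p) (-beta σ ε p) (1 + p * ε) (R σ ε) (-σ) (-p)

def VI (σ ε p : ℝ) : ℝ → ℝ := V ε σ (bb σ ε p) (mm σ ε p)

def VJ (σ ε p : ℝ) : ℝ → ℝ := V (-ε) (-σ) (-bb σ ε p) (mm σ ε p)

/-- The admissible range of parameters. -/
structure Adm (σ ε p : ℝ) : Prop where
  σ_pos : 0 < σ
  σ_lt : σ < 1 / 100
  σ_le : σ ≤ 10 * ε
  ε_pos : 0 < ε
  ε_le : ε ≤ 1 / 10
  le_p : 0.09 * ε ≤ p
  p_le : p ≤ 0.325 * ε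

/-! ### Uniform bounds on the admissible range -/

section Bounds

variable {σ ε p t : ℝ}

theorem Adm.p_pos (h : Adm σ ε p) : 0 < p := by
  have := h.le_p
  have := h.ε_pos
  linarith

theorem Adm.p_le' (h : Adm σ ε p) : p ≤ 0.0325 := by
  have := h.p_le
  have := h.ε_le
  linarith

theorem Adm.abs_σ (h : Adm σ ε p) : |σ| < 1 := by
  rw [abs_of_pos h.σ_pos]
  have := h.σ_lt
  linarith

theorem Adm.abs_neg_σ (h : Adm σ ε p) : |-σ| < 1 := by
  rw [abs_neg]
  exact h.abs_σ

theorem Adm.pε_le (h : Adm σ ε p) : p * ε ≤ 0.00325 := by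
  have h1 := h.p_le'
  have h2 := h.ε_le
  have h3 := h.p_pos
  have h4 := h.ε_pos
  nlinarith

theorem Adm.pε_pos (h : Adm σ ε p) : 0 < p * ε := mul_pos h.p_pos h.ε_pos

theorem Adm.σp_le (h : Adm σ ε p) : σ * p ≤ 0.000325 := by
  have h1 := h.p_le'
  have h2 := h.σ_lt
  have h3 := h.p_pos
  have h4 := h.σ_pos
  nlinarith

theorem Adm.σp_pos (h : Adm σ ε p) : 0 < σ * p := mul_pos h.σ_pos h.p_pos

theorem Adm.p_sq_le (h : Adm σ ε p) : p ^ 2 ≤ 0.00106 := by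
  have h1 := h.p_le'
  have h3 := h.p_pos
  nlinarith

theorem Adm.le_mm (h : Adm σ ε p) : 0.993 ≤ mm σ ε p := by
  have h1 := h.pε_le
  have h2 := h.pε_pos
  have h3 := h.σp_pos
  rw [mm, le_div_iff₀ (by positivity)]
  nlinarith [sq_nonneg p]

theorem Adm.mm_le (h : Adm σ ε p) : mm σ ε p ≤ 1.002 := by
  have h1 := h.pε_le
  have h2 := h.pε_pos
  have h3 := h.σp_le
  have h4 := h.p_sq_le
  rw [mm, div_le_iff₀ (by positivity)]
  nlinarith

theorem Adm.bb_le (h : Adm σ ε p) : bb σ ε p ≤ 0.0263 := by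
  have h1 := h.le_mm
  have h2 := h.p_pos
  have h3 := h.p_le'
  have h4 := h.σ_lt
  have : 0 ≤ p * ε ^ 2 * mm σ ε p := by positivity
  unfold bb
  linarith

theorem Adm.le_bb (h : Adm σ ε p) : σ ≤ bb σ ε p := by
  have h1 := h.mm_le
  have h0 := h.le_mm
  have h2 := h.p_pos
  have h3 : ε ^ 2 ≤ 0.01 := by nlinarith [h.ε_pos, h.ε_le]
  have h4 : ε ^ 2 * mm σ ε p ≤ 1 := by nlinarith [sq_nonneg ε]
  have : p * ε ^ 2 * mm σ ε p ≤ p := by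
    rw [mul_assoc]
    exact mul_le_of_le_one_right h2.le h4
  unfold bb
  linarith

theorem Adm.bb_pos (h : Adm σ ε p) : 0 < bb σ ε p := h.σ_pos.trans_le h.le_bb

theorem Adm.aa_sq (h : Adm σ ε p) : aa σ ε p ^ 2 = mm σ ε p - bb σ ε p ^ 2 := by
  refine Real.sq_sqrt ?_
  nlinarith [h.le_mm, h.bb_le, h.bb_pos]

theorem Adm.le_aa (h : Adm σ ε p) : 0.995 ≤ aa σ ε p := by
  refine Real.le_sqrt_of_sq_le ?_
  nlinarith [h.le_mm, h.bb_le, h.bb_pos]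

theorem Adm.aa_le (h : Adm σ ε p) : aa σ ε p ≤ 1.001 := by
  refine Real.sqrt_le_iff.mpr ⟨by norm_num, ?_⟩
  nlinarith [h.mm_le, sq_nonneg (bb σ ε p)]

theorem Adm.le_k2 (h : Adm σ ε p) : 0.9999 ≤ R σ ε := by
  refine Real.le_sqrt_of_sq_le ?_
  nlinarith [h.σ_lt, h.σ_pos, sq_nonneg (ε - σ)]

theorem Adm.k2_le (h : Adm σ ε p) : R σ ε ≤ 1.005 := by
  refine Real.sqrt_le_iff.mpr ⟨by norm_num, ?_⟩
  nlinarith [h.σ_pos, h.ε_pos, h.ε_le, mul_pos h.σ_pos h.ε_pos]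

/-- This turns the perturbations σt and bt into small fractions of S². -/
theorem two_mul_le_S_sq (t : ℝ) : 2 * t ≤ S t ^ 2 := by
  rw [S_sq]
  nlinarith [sq_nonneg (t - 1)]

theorem R_nonneg (σ t : ℝ) : 0 ≤ R σ t := Real.sqrt_nonneg _

theorem R_le_S (hσ : 0 ≤ σ) (ht : 0 < t) : R σ t ≤ S t := by
  refine Real.sqrt_le_sqrt ?_
  nlinarith [mul_nonneg hσ ht.le]

theorem le_R (hσ : 0 ≤ σ) (hσ2 : σ ≤ 1 / 100) : 0.99 * S t ≤ R σ t := by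
  refine Real.le_sqrt_of_sq_le ?_
  nlinarith [two_mul_le_S_sq t, S_sq t]

theorem S_le_R_neg (hσ : 0 ≤ σ) (ht : 0 < t) : S t ≤ R (-σ) t := by
  refine Real.sqrt_le_sqrt ?_
  nlinarith [mul_nonneg hσ ht.le]

theorem R_neg_le (hσ : 0 ≤ σ) (hσ2 : σ ≤ 1 / 100) : R (-σ) t ≤ 1.005 * S t := by
  have hS := S_pos t
  refine Real.sqrt_le_iff.mpr ⟨by positivity, ?_⟩
  nlinarith [two_mul_le_S_sq t, S_sq t]

/-- Lower bound for the denominator of `WA`. -/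
theorem Adm.le_denA (h : Adm σ ε p) (ht : 0 < t) :
    0.98 * (S t * (S t + t)) ≤ R σ t * ((1 + p * ε) * R σ t + R σ ε * (t + p)) := by
  have hS := S_pos t
  have h1 := le_R (t := t) h.σ_pos.le h.σ_lt.le
  have h2 := h.le_k2
  have h3 := h.p_pos
  have h4 := h.pε_pos
  calc 0.98 * (S t * (S t + t)) ≤ (0.99 * S t) * (1 * (0.99 * S t) + 0.9999 * (t + 0)) := by
        nlinarith [mul_pos hS ht]
    _ ≤ _ := by
        have := R_nonneg σ t
        gcongr
        linarith

theorem Adm.denA_le (h : Adm σ ε p) (ht : 0 < t) :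
    R σ t * ((1 + p * ε) * R σ t + R σ ε * (t + p)) ≤ 1.005 * (S t * (S t + t + p)) := by
  have hS := S_pos t
  have h1 := R_le_S h.σ_pos.le ht
  have hR := R_pos h.abs_σ t
  have h2 := h.k2_le
  have h3 := h.p_pos
  have h4 := h.pε_le
  have h5 := h.pε_pos
  calc R σ t * ((1 + p * ε) * R σ t + R σ ε * (t + p))
      ≤ S t * (1.005 * S t + 1.005 * (t + p)) := by
        have := R_nonneg σ ε
        refine mul_le_mul h1 ?_ (by positivity) hS.le
        gcongr
        linarith
    _ = _ := by ring

theorem Adm.le_denE_aux (h : Adm σ ε p) (ht : 0 < t) :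
    S t + 0.9999 * t - 1.005 * p ≤ (1 + p * ε) * R (-σ) t + R σ ε * (t + -p) := by
  have hS := S_pos t
  have h1 := S_le_R_neg h.σ_pos.le ht
  have h2 := h.le_k2
  have h3 := h.k2_le
  have h4 := h.p_pos
  have h5 := h.pε_pos
  nlinarith

/-- Lower bound for the denominator of `WE`. -/
theorem Adm.le_denE (h : Adm σ ε p) (ht : 0 < t) :
    0.966 * (S t * (S t + t)) ≤
      R (-σ) t * ((1 + p * ε) * R (-σ) t + R σ ε * (t + -p)) := by
  have hS := S_pos t
  have hS1 := one_le_S t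
  have h1 := S_le_R_neg h.σ_pos.le ht
  have h2 := h.le_denE_aux ht
  have h3 := h.p_le'
  -- Since S ≥ 1, the loss 1.005p ≤ 0.0327 is absorbed by 0.034 S.
  have h4 : 0.966 * (S t + t) ≤ S t + 0.9999 * t - 1.005 * p := by nlinarith
  calc 0.966 * (S t * (S t + t)) = S t * (0.966 * (S t + t)) := by ring
    _ ≤ _ := mul_le_mul h1 (h4.trans h2) (by positivity) (R_nonneg _ _)

theorem Adm.denE_le (h : Adm σ ε p) (ht : 0 < t) :
    R (-σ) t * ((1 + p * ε) * R (-σ) t + R σ ε * (t + -p)) ≤ 1.014 * (S t * (S t + t)) := by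
  have hS := S_pos t
  have h1 := R_neg_le (t := t) h.σ_pos.le h.σ_lt.le
  have hR := R_pos h.abs_neg_σ t
  have h2 := h.k2_le
  have h3 := h.p_pos
  have h4 := h.pε_le
  have h5 := h.pε_pos
  have h6 := h.le_k2
  have h7 : R σ ε * (t + -p) ≤ 1.005 * t := by nlinarith
  calc R (-σ) t * ((1 + p * ε) * R (-σ) t + R σ ε * (t + -p))
      ≤ (1.005 * S t) * ((1 + 0.00325) * (1.005 * S t) + 1.005 * t) := by
        refine mul_le_mul h1 ?_ ?_ (by positivity)
        · gcongr
        · have := h.le_denE_aux ht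
          nlinarith [one_le_S t, h.p_le']
    _ ≤ _ := by nlinarith [mul_pos hS ht]

theorem Adm.abs_alpha_le (h : Adm σ ε p) : |alpha σ ε p| ≤ 1.0067 := by
  have h1 := h.pε_pos
  have h2 := h.pε_le
  have h3 := h.σp_pos
  have h4 := h.σp_le
  have h5 := h.p_sq_le
  have h6 : 0 < (σ * p) * (p * ε) := by positivity
  have h7 : (σ * p) * (p * ε) ≤ 0.000325 * 0.00325 := by gcongr
  have e : alpha σ ε p = 1 - p ^ 2 + 2 * (p * ε) + 2 * ((σ * p) * (p * ε)) := by
    unfold alpha; ring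
  have h8 := sq_nonneg p
  rw [e, abs_le]
  constructor <;> nlinarith

theorem Adm.le_alpha (h : Adm σ ε p) : 0.9989 ≤ alpha σ ε p := by
  have h1 := h.pε_pos
  have h3 := h.σp_pos
  have h5 := h.p_sq_le
  have h6 : 0 < (σ * p) * (p * ε) := by positivity
  have e : alpha σ ε p = 1 - p ^ 2 + 2 * (p * ε) + 2 * ((σ * p) * (p * ε)) := by
    unfold alpha; ring
  rw [e]
  linarith

theorem Adm.abs_beta_le (h : Adm σ ε p) : |beta σ ε p| ≤ 1 := by
  have h1 := h.σ_pos
  have h2 := h.σ_lt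
  have h3 := h.p_pos
  have h4 := h.p_le'
  have h5 := h.ε_pos
  have h6 := h.ε_le
  have h7 : 0 < ε * p ^ 2 := by positivity
  have h8 : ε * p ^ 2 ≤ 0.1 * 0.00106 := by
    have := h.p_sq_le
    gcongr
    linarith
  unfold beta
  rw [abs_le]
  constructor <;> linarith

/-- A crude bound, needed only for integrability and for continuity in the parameters. -/
theorem abs_W_le {α β d : ℝ} (hα : |α| ≤ 2) (hβ : |β| ≤ 1) (ht : 0 < t)
    (hd : 0.9 * (S t * (S t + t)) ≤ d) : |(α + β * t) / d| ≤ 4 / S t := by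
  have hS := S_pos t
  have hS1 := one_le_S t
  have hw : 0 < S t * (S t + t) := by positivity
  have hd0 : 0 < d := by linarith
  rw [abs_div, abs_of_pos hd0, div_le_div_iff₀ hd0 hS]
  have h1 : |α + β * t| ≤ 2 + t := by
    refine (abs_add_le _ _).trans ?_
    rw [abs_mul, abs_of_pos ht]
    nlinarith
  have h2 : |α + β * t| * S t ≤ (2 + t) * S t := by gcongr
  nlinarith [mul_pos hS ht]

theorem Adm.abs_WA_le (h : Adm σ ε p) (ht : 0 < t) : |WA σ ε p t| ≤ 4 / S t := by
  have hw := w0_pos ht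
  exact abs_W_le (h.abs_alpha_le.trans (by norm_num)) h.abs_beta_le ht
    (by linarith [h.le_denA ht])

theorem Adm.abs_WE_le (h : Adm σ ε p) (ht : 0 < t) : |WE σ ε p t| ≤ 4 / S t := by
  have hw := w0_pos ht
  exact abs_W_le (h.abs_alpha_le.trans (by norm_num))
    (by rw [abs_neg]; exact h.abs_beta_le) ht (by linarith [h.le_denE ht])

theorem continuous_R (σ : ℝ) : Continuous (R σ) := by
  unfold R
  fun_prop

theorem Adm.denA_pos (h : Adm σ ε p) (ht : 0 < t) :
    0 < R σ t * ((1 + p * ε) * R σ t + R σ ε * (t + p)) :=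
  lt_of_lt_of_le (mul_pos (by norm_num) (w0_pos ht)) (h.le_denA ht)

theorem Adm.denE_pos (h : Adm σ ε p) (ht : 0 < t) :
    0 < R (-σ) t * ((1 + p * ε) * R (-σ) t + R σ ε * (t + -p)) :=
  lt_of_lt_of_le (mul_pos (by norm_num) (w0_pos ht)) (h.le_denE ht)

theorem Adm.continuousOn_WA (h : Adm σ ε p) : ContinuousOn (WA σ ε p) (Ioi 0) := by
  have hR := continuous_R σ
  refine ContinuousOn.div (by fun_prop) (by fun_prop) fun t ht => (h.denA_pos ht).ne'

theorem Adm.continuousOn_WE (h : Adm σ ε p) : ContinuousOn (WE σ ε p) (Ioi 0) := by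
  have hR := continuous_R (-σ)
  refine ContinuousOn.div (by fun_prop) (by fun_prop) fun t ht => (h.denE_pos ht).ne'

theorem Adm.HInt_WA (h : Adm σ ε p) : HInt (WA σ ε p) :=
  HInt.of_bound h.continuousOn_WA fun _ ht => h.abs_WA_le ht

theorem Adm.HInt_WE (h : Adm σ ε p) : HInt (WE σ ε p) :=
  HInt.of_bound h.continuousOn_WE fun _ ht => h.abs_WE_le ht

theorem Adm.le_quadI (h : Adm σ ε p) (t : ℝ) :
    0.966 * S t ^ 2 ≤ t ^ 2 - 2 * bb σ ε p * t + mm σ ε p := by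
  have h1 := h.le_mm
  have h2 := h.bb_le
  have h3 := h.bb_pos
  have h4 := two_mul_le_S_sq t
  have h5 := S_sq t
  nlinarith [sq_nonneg t]

theorem Adm.le_quadJ (h : Adm σ ε p) (ht : 0 < t) :
    0.993 * S t ^ 2 ≤ t ^ 2 - 2 * -bb σ ε p * t + mm σ ε p := by
  have h1 := h.le_mm
  have h3 := mul_pos h.bb_pos ht
  have h5 := S_sq t
  nlinarith [sq_nonneg t]

theorem Adm.quadJ_le (h : Adm σ ε p) (ht : 0 < t) :
    t ^ 2 - 2 * -bb σ ε p * t + mm σ ε p ≤ 1.0285 * S t ^ 2 := by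
  have h1 := h.mm_le
  have h2 := h.bb_le
  have h4 := two_mul_le_S_sq t
  have h5 := S_sq t
  nlinarith [sq_nonneg t]

theorem Adm.le_denI (h : Adm σ ε p) (t : ℝ) :
    0.956 * S t ^ 3 ≤ R σ t * (t ^ 2 - 2 * bb σ ε p * t + mm σ ε p) := by
  have h1 := le_R (t := t) h.σ_pos.le h.σ_lt.le
  have h2 := h.le_quadI t
  have hS := S_pos t
  calc 0.956 * S t ^ 3 ≤ (0.99 * S t) * (0.966 * S t ^ 2) := by
        nlinarith [pow_pos hS 3]
    _ ≤ _ := mul_le_mul h1 h2 (by positivity) (R_nonneg _ _)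

theorem Adm.le_denJ (h : Adm σ ε p) (ht : 0 < t) :
    0.993 * S t ^ 3 ≤ R (-σ) t * (t ^ 2 - 2 * -bb σ ε p * t + mm σ ε p) := by
  have h1 := S_le_R_neg h.σ_pos.le ht
  have h2 := h.le_quadJ ht
  have hS := S_pos t
  calc 0.993 * S t ^ 3 = S t * (0.993 * S t ^ 2) := by ring
    _ ≤ _ := mul_le_mul h1 h2 (by positivity) (R_nonneg _ _)

theorem Adm.denJ_le (h : Adm σ ε p) (ht : 0 < t) :
    R (-σ) t * (t ^ 2 - 2 * -bb σ ε p * t + mm σ ε p) ≤ 1.034 * S t ^ 3 := by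
  have h1 := R_neg_le (t := t) h.σ_pos.le h.σ_lt.le
  have h2 := h.quadJ_le ht
  have hR := R_pos h.abs_neg_σ t
  have hS := S_pos t
  calc R (-σ) t * (t ^ 2 - 2 * -bb σ ε p * t + mm σ ε p)
      ≤ (1.005 * S t) * (1.0285 * S t ^ 2) := by
        refine mul_le_mul h1 h2 ?_ (by positivity)
        exact le_trans (by positivity) (h.le_quadJ ht)
    _ ≤ _ := by nlinarith [pow_pos hS 3]

theorem abs_V_le {d : ℝ} (hε : |ε| ≤ 1) (ht : 0 < t) (hd : 0.9 * S t ^ 3 ≤ d) :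
    |(1 - ε * t) / d| ≤ 4 / S t := by
  have hS := S_pos t
  have hS1 := one_le_S t
  have hw : 0 < S t ^ 3 := by positivity
  have hd0 : 0 < d := by linarith
  rw [abs_div, abs_of_pos hd0, div_le_div_iff₀ hd0 hS]
  have h1 : |1 - ε * t| ≤ 1 + t := by
    refine (abs_sub _ _).trans ?_
    rw [abs_mul, abs_of_pos ht, abs_one]
    nlinarith
  have h2 : |1 - ε * t| * S t ≤ (1 + t) * S t := by gcongr
  have h3 : S t ^ 2 ≤ S t ^ 3 := pow_le_pow_right₀ hS1 (by norm_num)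
  nlinarith [le_S t]

theorem Adm.abs_ε (h : Adm σ ε p) : |ε| ≤ 1 := by
  rw [abs_of_pos h.ε_pos]
  linarith [h.ε_le]

theorem Adm.abs_VI_le (h : Adm σ ε p) (ht : 0 < t) : |VI σ ε p t| ≤ 4 / S t := by
  have hw := pow_pos (S_pos t) 3
  exact abs_V_le h.abs_ε ht (by linarith [h.le_denI t])

theorem Adm.abs_VJ_le (h : Adm σ ε p) (ht : 0 < t) : |VJ σ ε p t| ≤ 4 / S t := by
  have hw := pow_pos (S_pos t) 3
  exact abs_V_le (by rw [abs_neg]; exact h.abs_ε) ht (by linarith [h.le_denJ ht])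

theorem Adm.denI_pos (h : Adm σ ε p) (t : ℝ) :
    0 < R σ t * (t ^ 2 - 2 * bb σ ε p * t + mm σ ε p) :=
  lt_of_lt_of_le (mul_pos (by norm_num) (pow_pos (S_pos t) 3)) (h.le_denI t)

theorem Adm.denJ_pos (h : Adm σ ε p) (ht : 0 < t) :
    0 < R (-σ) t * (t ^ 2 - 2 * -bb σ ε p * t + mm σ ε p) :=
  lt_of_lt_of_le (mul_pos (by norm_num) (pow_pos (S_pos t) 3)) (h.le_denJ ht)

theorem Adm.continuousOn_VI (h : Adm σ ε p) : ContinuousOn (VI σ ε p) (Ioi 0) := by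
  have hR := continuous_R σ
  refine ContinuousOn.div (by fun_prop) (by fun_prop) fun t _ => (h.denI_pos t).ne'

theorem Adm.continuousOn_VJ (h : Adm σ ε p) : ContinuousOn (VJ σ ε p) (Ioi 0) := by
  have hR := continuous_R (-σ)
  refine ContinuousOn.div (by fun_prop) (by fun_prop) fun t ht => (h.denJ_pos ht).ne'

theorem Adm.HInt_VI (h : Adm σ ε p) : HInt (VI σ ε p) :=
  HInt.of_bound h.continuousOn_VI fun _ ht => h.abs_VI_le ht

theorem Adm.HInt_VJ (h : Adm σ ε p) : HInt (VJ σ ε p) :=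
  HInt.of_bound h.continuousOn_VJ fun _ ht => h.abs_VJ_le ht

end Bounds

/-! ### Estimates of the integrals and of the reduced equations -/

section Estimates

variable {σ ε p t : ℝ}

theorem Adm.alpha_le (h : Adm σ ε p) : alpha σ ε p ≤ 1.0067 := (le_abs_self _).trans h.abs_alpha_le

theorem Adm.beta_le (h : Adm σ ε p) : beta σ ε p ≤ ε := by
  have h1 := h.σ_pos
  have h3 := h.p_pos
  have : 0 < ε * p ^ 2 := mul_pos h.ε_pos (pow_pos h3 2)
  unfold beta
  linarith

theorem Adm.neg_beta_le (h : Adm σ ε p) : -beta σ ε p ≤ 2 * σ := by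
  have h1 := h.p_sq_le
  have h2 := h.p_le
  have h3 := h.ε_pos
  unfold beta
  nlinarith

/-- The constants bound 0.9989/1.014 from below and 0.1/0.966 from above: the α-term uses the upper
bound for the denominator, the β-term the lower one. -/
theorem Adm.le_hInt_WE (h : Adm σ ε p) : 1.38 ≤ hInt (WE σ ε p) := by
  have hb := h.beta_le
  have hε := h.ε_le
  have hα := h.le_alpha
  have hle := hInt_mono ((HInt_w0.const_mul 0.985).add (HInt_t_w0.const_mul (-0.1036)))
    h.HInt_WE fun t ht => by
      have hd := h.denE_pos ht
      have h1 := h.denE_le ht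
      have h2 := h.le_denE ht
      have hw := w0_pos ht
      unfold WE W
      rw [mul_one_div, mul_div_assoc', ← add_div, div_le_div_iff₀ hw hd]
      have hE1 : 0.1 * t * (S t * (S t + t)) ≤ 0.1036 * t *
          (R (-σ) t * ((1 + p * ε) * R (-σ) t + R σ ε * (t + -p))) := by
        nlinarith
      nlinarith [mul_pos ht hw]
  rw [hInt_add (HInt_w0.const_mul 0.985) (HInt_t_w0.const_mul (-0.1036)), hInt_const_mul,
    hInt_const_mul, hInt_t_w0] at hle
  change 0.985 * cc + _ ≤ _ at hle
  have := le_cc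
  have := K_le
  linarith

theorem Adm.hInt_WE_le (h : Adm σ ε p) : hInt (WE σ ε p) ≤ 1.87 := by
  have hb := h.neg_beta_le
  have hσ := h.σ_lt
  have hα := h.alpha_le
  have hα0 := h.le_alpha
  have hle := hInt_mono h.HInt_WE ((HInt_w0.const_mul 1.0422).add (HInt_t_w0.const_mul 0.02071))
    fun t ht => by
      have hd := h.denE_pos ht
      have h2 := h.le_denE ht
      have hw := w0_pos ht
      unfold WE W
      rw [mul_one_div, mul_div_assoc', ← add_div, div_le_div_iff₀ hd hw]
      have hE1 : (alpha σ ε p + -beta σ ε p * t) * (S t * (S t + t)) ≤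
          (1.0067 + 0.02 * t) * (S t * (S t + t)) := by
        gcongr
        linarith
      nlinarith [mul_pos ht hw]
  rw [hInt_add (HInt_w0.const_mul _) (HInt_t_w0.const_mul _), hInt_const_mul,
    hInt_const_mul, hInt_t_w0] at hle
  change _ ≤ 1.0422 * cc + _ at hle
  have := cc_le
  have := K_le
  linarith

theorem Adm.hInt_VJ_le (h : Adm σ ε p) : hInt (VJ σ ε p) ≤ 1.99 := by
  have hε := h.ε_le
  have hε0 := h.ε_pos
  have hle := hInt_mono h.HInt_VJ ((HInt_cube.const_mul 1.0071).add (HInt_t_cube.const_mul 0.10071))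
    fun t ht => by
      have hd := h.denJ_pos ht
      have h2 := h.le_denJ ht
      have hw := pow_pos (S_pos t) 3
      unfold VJ V
      rw [mul_one_div, mul_div_assoc', ← add_div, div_le_div_iff₀ hd hw]
      have hE1 : (1 - -ε * t) * S t ^ 3 ≤ (1 + 0.1 * t) * S t ^ 3 := by
        gcongr
        nlinarith
      nlinarith [mul_pos ht hw]
  rw [hInt_add (HInt_cube.const_mul _) (HInt_t_cube.const_mul _), hInt_const_mul,
    hInt_const_mul, hInt_t_cube, hInt_cube] at hle
  have := cc_le
  have := K_le
  linarith

theorem Adm.le_hInt_VJ (h : Adm σ ε p) : 1.74 ≤ hInt (VJ σ ε p) := by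
  have hε0 := h.ε_pos
  have hle := hInt_mono (HInt_cube.const_mul 0.967) h.HInt_VJ
    fun t ht => by
      have hd := h.denJ_pos ht
      have h2 := h.denJ_le ht
      have hw := pow_pos (S_pos t) 3
      unfold VJ V
      rw [mul_one_div, div_le_div_iff₀ hw hd]
      nlinarith [mul_pos (mul_pos hε0 ht) hw]
  rw [hInt_const_mul, hInt_cube] at hle
  have := le_K
  linarith

theorem Adm.denI_le (h : Adm σ ε p) (ht : 0 < t) :
    R σ t * (t ^ 2 - 2 * bb σ ε p * t + mm σ ε p) ≤ 1.002 * S t ^ 3 := by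
  have h1 := R_le_S h.σ_pos.le ht
  have hS := S_pos t
  have h2 : t ^ 2 - 2 * bb σ ε p * t + mm σ ε p ≤ 1.002 * S t ^ 2 := by
    have := h.mm_le
    have := mul_pos h.bb_pos ht
    nlinarith [S_sq t, sq_nonneg t]
  calc R σ t * (t ^ 2 - 2 * bb σ ε p * t + mm σ ε p) ≤ S t * (1.002 * S t ^ 2) := by
        refine mul_le_mul h1 h2 ?_ hS.le
        exact le_trans (by positivity) (h.le_quadI t)
    _ = _ := by ring

theorem Adm.hInt_VI_pos (h : Adm σ ε p) : 1 ≤ hInt (VI σ ε p) := by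
  have hε := h.ε_le
  have hε0 := h.ε_pos
  have hle := hInt_mono ((HInt_cube.const_mul 0.998).add (HInt_t_cube.const_mul (-0.1047)))
    h.HInt_VI fun t ht => by
      have hd := h.denI_pos t
      have h1 := h.denI_le ht
      have h2 := h.le_denI t
      have hw := pow_pos (S_pos t) 3
      unfold VI V
      rw [mul_one_div, mul_div_assoc', ← add_div, div_le_div_iff₀ hw hd]
      have hE1 : 0.1 * t * S t ^ 3 ≤ 0.1047 * t *
          (R σ t * (t ^ 2 - 2 * bb σ ε p * t + mm σ ε p)) := by
        nlinarith
      have hE2 : ε * t * S t ^ 3 ≤ 0.1 * t * S t ^ 3 := by gcongr; linarith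
      nlinarith [mul_pos ht hw]
  rw [hInt_add (HInt_cube.const_mul _) (HInt_t_cube.const_mul _), hInt_const_mul,
    hInt_const_mul, hInt_t_cube, hInt_cube] at hle
  have := cc_le
  have := le_K
  linarith

theorem Adm.hInt_VI_le (h : Adm σ ε p) : hInt (VI σ ε p) ≤ 1.98 := by
  have hε0 := h.ε_pos
  have hle := hInt_mono h.HInt_VI (HInt_cube.const_mul 1.0461)
    fun t ht => by
      have hd := h.denI_pos t
      have h2 := h.le_denI t
      have hw := pow_pos (S_pos t) 3
      unfold VI V
      rw [mul_one_div, div_le_div_iff₀ hd hw]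
      nlinarith [mul_pos (mul_pos hε0 ht) hw]
  rw [hInt_const_mul, hInt_cube] at hle
  have := K_le
  linarith

/-- The reduced third period equation is `Gfun = 0`. -/
def Gfun (σ ε p κ : ℝ) : ℝ :=
  hInt (WE σ ε p) - 2 * aa σ ε p * R (-σ) p * κ * hInt (VJ σ ε p)

/-- The ratio of `r` and `a f(λ) / ((λ + b)² + a²)`. -/
def ratio (σ ε p κ : ℝ) : ℝ := κ * ε * R σ ε * √(mm σ ε p) / (aa σ ε p * (1 + p * ε))

/-- The reduced second period equation, after elimination, is `Ffun = 0`. -/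
def Ffun (σ ε p κ : ℝ) : ℝ :=
  hInt (WE σ ε p) * hInt (VI σ ε p) * (1 - ratio σ ε p κ) - hInt (WA σ ε p) * hInt (VJ σ ε p)

/-- The subtracted product is at most about 1.20, below 1.38. At κ = 0.57 it is at least about 1.97,
above 1.87, so the sign is reversed there. -/
theorem Adm.Gfun_pos (h : Adm σ ε p) : 0 < Gfun σ ε p 0.3 := by
  have h1 := h.le_hInt_WE
  have h2 := h.hInt_VJ_le
  have h3 := h.aa_le
  have h4 : R (-σ) p ≤ 1.001 := by
    refine Real.sqrt_le_iff.mpr ⟨by norm_num, ?_⟩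
    nlinarith [h.σp_le, h.p_sq_le]
  have h5 := h.le_aa
  have h6 := h.le_hInt_VJ
  have h7 := R_nonneg (-σ) p
  have : 2 * aa σ ε p * R (-σ) p * 0.3 * hInt (VJ σ ε p) ≤ 2 * 1.001 * 1.001 * 0.3 * 1.99 := by
    gcongr
  unfold Gfun
  linarith

theorem Adm.Gfun_neg (h : Adm σ ε p) : Gfun σ ε p 0.57 < 0 := by
  have h1 := h.hInt_WE_le
  have h2 := h.le_hInt_VJ
  have h3 := h.le_aa
  have h4 : 1 ≤ R (-σ) p := by
    refine Real.le_sqrt_of_sq_le ?_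
    nlinarith [h.σp_pos]
  have : 2 * 0.995 * 1 * 0.57 * 1.74 ≤ 2 * aa σ ε p * R (-σ) p * 0.57 * hInt (VJ σ ε p) := by
    gcongr
  unfold Gfun
  linarith

/-! ### The end `ε = 1/10` -/

/-- Here P stands for S² and M for t² + m. After expansion, the gain 0.2·t·P·M due to ε = 1/10
outweighs the losses of order σ and b, which is `a4` multiplied by t. -/
theorem low_end_ineq {P M b : ℝ} (hσ : 0 < σ) (hσ2 : σ < 1 / 100) (hb : 0 < b)
    (hb2 : b ≤ 0.0263) (ht : 0 < t) (ht10 : t ≤ 10) (hP : 1 ≤ P) (hM : 0.993 ≤ M) (_ : 2 * t ≤ P) :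
    (1 - 1 / 10 * t) * (P + σ * t) * (M + 2 * b * t) ≤
      (1 + 1 / 10 * t) * (P - 1.01 * (σ * t)) * (M - 2 * b * t) := by
  have hM0 : 0 < M := by linarith
  have hP0 : 0 < P := by linarith
  have a0 : 0.993 * P ≤ P * M := by
    rw [mul_comm]
    gcongr
  have a1 : σ * M ≤ 0.01 * (P * M) := by
    calc σ * M ≤ 0.01 * (1 * M) := by rw [one_mul]; gcongr; linarith
      _ ≤ _ := by gcongr
  have a2 : b * P ≤ 0.0263 * P := by gcongr
  have a3 : σ * b * t ≤ 0.01 * 0.0263 * t := by gcongr; linarith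
  have a4 : 2.02 * (σ * M) + 4 * (b * P) + 4.04 * (σ * b * t) ≤ 0.2 * (P * M) := by linarith
  have a5 := mul_le_mul_of_nonneg_left a4 ht.le
  have hx : 0 ≤ 1 - 1 / 10 * t := by linarith
  have b1 : 0 ≤ (1 - 1 / 10 * t) * (σ * t * M) := by positivity
  have b2 : 0 < (σ * t) * (b * t) := by positivity
  have b3 : 0 < (σ * t) * (b * t) * t := by positivity
  linarith

/-- Completing the square under the root: S²(S² + 2σt) ≤ (S² + σt)². The factor S in the product
removes the square root from the bound. -/
theorem R_neg_mul_S_le (hσ : 0 < σ) (ht : 0 < t) : R (-σ) t * S t ≤ S t ^ 2 + σ * t := by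
  have h1 : 0 ≤ t ^ 2 - 2 * -σ * t + 1 := by nlinarith [mul_pos hσ ht]
  rw [R, S, ← Real.sqrt_mul h1, Real.sq_sqrt (by positivity)]
  refine Real.sqrt_le_iff.mpr ⟨by positivity, ?_⟩
  linarith [sq_nonneg (σ * t)]

theorem le_R_mul_S (hσ : 0 < σ) (hσ2 : σ < 1 / 100) (ht : 0 < t) :
    S t ^ 2 - 1.01 * (σ * t) ≤ R σ t * S t := by
  have h1 := R_arg_pos (σ := σ) (by rw [abs_of_pos hσ]; linarith) t
  rw [R, S, ← Real.sqrt_mul h1.le, Real.sq_sqrt (by positivity)]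
  refine Real.le_sqrt_of_sq_le ?_
  have h2 : 0 < σ * t := mul_pos hσ ht
  have h3 : σ * t ≤ 1 / 100 * t := by gcongr
  have h4 : σ * t ≤ 0.005 * (1 + t ^ 2) := by linarith [sq_nonneg (t - 1)]
  have h5 : 1.01 ^ 2 * (σ * t) ≤ 0.02 * (1 + t ^ 2) := by linarith
  have h6 := mul_le_mul_of_nonneg_left h5 h2.le
  linarith

theorem Adm.VI_le_VJ (h : Adm σ (1 / 10) p) (ht : 0 < t) :
    VI σ (1 / 10) p t ≤ VJ σ (1 / 10) p t := by
  have hdI := h.denI_pos t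
  have hdJ := h.denJ_pos ht
  unfold VI VJ V
  rw [div_le_div_iff₀ hdI hdJ]
  -- For t ≥ 10 the factor 1 - t/10 makes `VI` nonpositive, while `VJ` is positive.
  rcases le_or_gt 10 t with ht10 | ht10
  · exact (mul_nonpos_of_nonpos_of_nonneg (by linarith) hdJ.le).trans
      (mul_nonneg (by linarith) hdI.le)
  have hS := S_pos t
  have hb := h.bb_pos
  have hY := R_neg_mul_S_le h.σ_pos ht
  have hX := le_R_mul_S h.σ_pos h.σ_lt ht
  have hqI := h.le_quadI t
  have hM : 0.993 ≤ t ^ 2 + mm σ (1 / 10) p := by linarith [h.le_mm, sq_nonneg t]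
  have hP : 1 ≤ S t ^ 2 := one_le_pow₀ (one_le_S t)
  have step := low_end_ineq h.σ_pos h.σ_lt hb h.bb_le ht ht10.le hP hM (two_mul_le_S_sq t)
  have hMm : 0 < t ^ 2 + mm σ (1 / 10) p - 2 * bb σ (1 / 10) p * t :=
    lt_of_lt_of_le (by positivity) (hqI.trans_eq (by ring))
  have hMp : 0 < t ^ 2 + mm σ (1 / 10) p + 2 * bb σ (1 / 10) p * t := by positivity
  have hx : 0 < 1 - 1 / 10 * t := by linarith
  refine le_of_mul_le_mul_right ?_ hS
  calc (1 - 1 / 10 * t) *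
        (R (-σ) t * (t ^ 2 - 2 * -bb σ (1 / 10) p * t + mm σ (1 / 10) p)) * S t
      = (1 - 1 / 10 * t) * (R (-σ) t * S t) *
        (t ^ 2 + mm σ (1 / 10) p + 2 * bb σ (1 / 10) p * t) := by ring
    _ ≤ (1 - 1 / 10 * t) * (S t ^ 2 + σ * t) *
        (t ^ 2 + mm σ (1 / 10) p + 2 * bb σ (1 / 10) p * t) := by gcongr
    _ ≤ _ := step
    _ ≤ (1 + 1 / 10 * t) * (R σ t * S t) *
        (t ^ 2 + mm σ (1 / 10) p - 2 * bb σ (1 / 10) p * t) := by gcongr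
    _ = _ := by ring

/-- First-order expansion in p: 1/(v - p) ≤ 1/v + 1.04p/v² for v = S + t ≥ 1, because 1/(1 - 0.0325)
< 1.04. The last coefficient uses 0.986 < 1/1.014. -/
theorem Adm.WE_le (h : Adm σ (1 / 10) p) (ht : 0 < t) (hβ : 0 ≤ beta σ (1 / 10) p) :
    WE σ (1 / 10) p t ≤ alpha σ (1 / 10) p * (1 / (S t * (S t + t))) +
      1.04 * p * alpha σ (1 / 10) p * (1 / (S t * (S t + t) ^ 2)) +
      (-(0.986 * beta σ (1 / 10) p)) * (t / (S t * (S t + t))) := by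
  have hd := h.denE_pos ht
  have hd2 := h.denE_le ht
  have hw := w0_pos ht
  have hS := S_pos t
  have hS1 := one_le_S t
  have hα := h.le_alpha
  have hp := h.p_pos
  have hp2 := h.p_le'
  have hk2 : 1 ≤ R σ (1 / 10) := by
    refine Real.le_sqrt_of_sq_le ?_
    linarith [h.σ_lt]
  have hk2' := h.k2_le
  have hY := S_le_R_neg h.σ_pos.le ht
  have hD : S t * (S t + t - p) ≤
      R (-σ) t * ((1 + p * (1 / 10)) * R (-σ) t + R σ (1 / 10) * (t + -p)) := by
    refine mul_le_mul hY ?_ (by linarith) (R_nonneg _ _)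
    nlinarith
  have hE : 0 < S t * (S t + t - p) := mul_pos hS (by linarith)
  have e : WE σ (1 / 10) p t = alpha σ (1 / 10) p *
      (1 / (R (-σ) t * ((1 + p * (1 / 10)) * R (-σ) t + R σ (1 / 10) * (t + -p)))) -
      beta σ (1 / 10) p * (t /
      (R (-σ) t * ((1 + p * (1 / 10)) * R (-σ) t + R σ (1 / 10) * (t + -p)))) := by
    unfold WE W
    ring
  rw [e]
  generalize R (-σ) t * ((1 + p * (1 / 10)) * R (-σ) t + R σ (1 / 10) * (t + -p)) = D at *
  have h1 : 1 / D ≤ 1 / (S t * (S t + t)) + 1.04 * p * (1 / (S t * (S t + t) ^ 2)) := by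
    refine (one_div_le_one_div_of_le hE hD).trans ?_
    have hu : 0 < S t + t - p := by linarith
    have hv : 0 < S t + t := by linarith
    have e2 : 1 / (S t * (S t + t)) + 1.04 * p * (1 / (S t * (S t + t) ^ 2)) =
        (S t + t + 1.04 * p) / (S t * (S t + t) ^ 2) := by
      field_simp
    rw [e2, div_le_div_iff₀ hE (by positivity)]
    have h3 : (S t + t) ^ 2 ≤ (S t + t + 1.04 * p) * (S t + t - p) := by nlinarith
    nlinarith
  have h2 : 0.986 * (t / (S t * (S t + t))) ≤ t / D := by
    have h3 : t / (1.014 * (S t * (S t + t))) ≤ t / D := by gcongr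
    refine le_trans ?_ h3
    rw [mul_div_assoc', div_le_div_iff₀ hw (by positivity)]
    nlinarith [mul_pos ht hw]
  have h3 := mul_le_mul_of_nonneg_left h1 (a := alpha σ (1 / 10) p) (by linarith)
  have h4 := mul_le_mul_of_nonneg_left h2 hβ
  calc _ ≤ alpha σ (1 / 10) p *
        (1 / (S t * (S t + t)) + 1.04 * p * (1 / (S t * (S t + t) ^ 2))) -
        beta σ (1 / 10) p * (0.986 * (t / (S t * (S t + t)))) := by linarith
    _ = _ := by ring

/-- The companion expansion 1/(v + p) ≥ 1/v - p/v² with v = S + t; the factor 0.995 is below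
1/1.005. -/
theorem Adm.le_WA (h : Adm σ ε p) (ht : 0 < t) (hβ : 0 ≤ beta σ ε p) :
    (0.995 * alpha σ ε p) * (1 / (S t * (S t + t))) +
      (-(0.995 * (p * alpha σ ε p))) * (1 / (S t * (S t + t) ^ 2)) +
      (0.995 * ((1 - p) * beta σ ε p)) * (t / (S t * (S t + t))) ≤ WA σ ε p t := by
  have hd := h.denA_pos ht
  have hD := h.denA_le ht
  have hS := S_pos t
  have hS1 := one_le_S t
  have hα := h.le_alpha
  have hp := h.p_pos
  have hp2 := h.p_le'
  have e : WA σ ε p t = alpha σ ε p *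
      (1 / (R σ t * ((1 + p * ε) * R σ t + R σ ε * (t + p)))) +
      beta σ ε p * (t / (R σ t * ((1 + p * ε) * R σ t + R σ ε * (t + p)))) := by
    unfold WA W
    ring
  rw [e]
  generalize R σ t * ((1 + p * ε) * R σ t + R σ ε * (t + p)) = D at *
  have hv : 0 < S t + t := by linarith
  have hE : 0 < 1.005 * (S t * (S t + t + p)) := by positivity
  have h0 := one_div_le_one_div_of_le hd hD
  have h1 : 0.995 * (1 / (S t * (S t + t)) - p * (1 / (S t * (S t + t) ^ 2))) ≤ 1 / D := by
    refine le_trans ?_ h0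
    have e2 : 1 / (S t * (S t + t)) - p * (1 / (S t * (S t + t) ^ 2)) =
        (S t + t - p) / (S t * (S t + t) ^ 2) := by
      field_simp
    rw [e2, mul_div_assoc', div_le_div_iff₀ (by positivity) hE]
    have h3 : (S t + t - p) * (S t + t + p) ≤ (S t + t) ^ 2 := by nlinarith
    have h4 := mul_le_mul_of_nonneg_left h3 hS.le
    have h5 : 0 < S t * (S t + t) ^ 2 := by positivity
    linarith
  have h2 : 0.995 * ((1 - p) * (t / (S t * (S t + t)))) ≤ t / D := by
    have h3 : t / (1.005 * (S t * (S t + t + p))) ≤ t / D := by gcongr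
    refine le_trans ?_ h3
    rw [mul_div_assoc', mul_div_assoc', div_le_div_iff₀ (by positivity) hE]
    have h4 : (1 - p) * (S t + t + p) ≤ S t + t := by nlinarith
    have h5 := mul_le_mul_of_nonneg_left h4 (mul_pos ht hS).le
    have h6 : 0 < t * S t * (S t + t) := by positivity
    linarith
  have h3 := mul_le_mul_of_nonneg_left h1 (a := alpha σ ε p) (by linarith)
  have h4 := mul_le_mul_of_nonneg_left h2 hβ
  calc _ = alpha σ ε p *
        (0.995 * (1 / (S t * (S t + t)) - p * (1 / (S t * (S t + t) ^ 2)))) +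
        beta σ ε p * (0.995 * ((1 - p) * (t / (S t * (S t + t))))) := by ring
    _ ≤ _ := by linarith

end Estimates

/-! ### Signs of `Ffun` at the two ends of the range of ε -/

section Signs

variable {σ ε p t κ : ℝ}

theorem Adm.sqrt_mm_le (h : Adm σ ε p) : √(mm σ ε p) ≤ 1.001 := by
  refine Real.sqrt_le_iff.mpr ⟨by norm_num, ?_⟩
  linarith [h.mm_le]

theorem aa_le_sqrt (σ ε p : ℝ) : aa σ ε p ≤ √(mm σ ε p) := by
  refine Real.sqrt_le_sqrt ?_
  linarith [sq_nonneg (bb σ ε p)]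

theorem Adm.ratio_le (h : Adm σ ε p) (hκ : κ ≤ 0.57) :
    ratio σ ε p κ ≤ 0.58 * ε := by
  have h1 := h.sqrt_mm_le
  have h2 := h.le_aa
  have h3 := h.k2_le
  have h4 := h.pε_pos
  have h5 := h.ε_pos
  have h6 := R_nonneg σ ε
  unfold ratio
  rw [div_le_iff₀ (by positivity)]
  calc κ * ε * R σ ε * √(mm σ ε p) ≤ 0.57 * ε * 1.005 * 1.001 := by gcongr
    _ ≤ 0.58 * ε * (0.995 * (1 + 0)) := by linarith
    _ ≤ _ := by gcongr

theorem Adm.le_ratio (h : Adm σ (1 / 10) p) (hκ0 : 0 ≤ κ) :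
    0.0996 * κ ≤ ratio σ (1 / 10) p κ := by
  have h1 := aa_le_sqrt σ (1 / 10) p
  have h2 := h.le_aa
  have h4 := h.pε_le
  have h5 := h.pε_pos
  have hk2 : 1 ≤ R σ (1 / 10) := by
    refine Real.le_sqrt_of_sq_le ?_
    linarith [h.σ_lt]
  unfold ratio
  rw [le_div_iff₀ (by positivity)]
  calc 0.0996 * κ * (aa σ (1 / 10) p * (1 + p * (1 / 10)))
      ≤ 0.0996 * κ * (aa σ (1 / 10) p * (1 + 0.00325)) := by gcongr
    _ ≤ κ * (1 / 10) * 1 * aa σ (1 / 10) p := by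
        have : 0 ≤ κ * aa σ (1 / 10) p := by positivity
        linarith
    _ ≤ _ := by gcongr

theorem Adm.beta_low (h : Adm σ (1 / 10) p) : 0.0798 - 2 * p ≤ beta σ (1 / 10) p := by
  have := h.p_sq_le
  have := h.σ_lt
  unfold beta
  linarith

/-- The terms α·`cc` cancel up to 0.5 percent. The p-terms and the β-terms are all multiples of K/3,
with opposite signs. -/
theorem Adm.hInt_WE_sub_WA_le (h : Adm σ (1 / 10) p) :
    hInt (WE σ (1 / 10) p) - hInt (WA σ (1 / 10) p) ≤
      0.0089 + K / 3 * (5.99 * p - 0.1554) := by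
  have hβ := h.beta_low
  have hp := h.p_le'
  have hp0 := h.p_pos
  have hβ0 : 0 ≤ beta σ (1 / 10) p := by linarith
  have i1 := HInt_w0
  have i2 := HInt_w0_sq
  have i3 := HInt_t_w0
  have hE := hInt_mono h.HInt_WE (((i1.const_mul _).add (i2.const_mul _)).add (i3.const_mul _))
    fun t ht => h.WE_le ht hβ0
  have hA := hInt_mono (((i1.const_mul _).add (i2.const_mul _)).add (i3.const_mul _)) h.HInt_WA
    fun t ht => h.le_WA ht hβ0
  rw [hInt_add ((i1.const_mul _).add (i2.const_mul _)) (i3.const_mul _),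
    hInt_add (i1.const_mul _) (i2.const_mul _), hInt_const_mul, hInt_const_mul, hInt_const_mul,
    hInt_w0_sq, hInt_t_w0] at hE hA
  change _ ≤ _ * cc + _ + _ at hE
  change _ * cc + _ + _ ≤ _ at hA
  have hα := h.alpha_le
  have hα0 := h.le_alpha
  have hc := cc_le
  have hc0 := le_cc
  have hK0 := le_K
  have hK := K_le
  generalize hInt (WE σ (1 / 10) p) = E at *
  generalize hInt (WA σ (1 / 10) p) = A at *
  generalize alpha σ (1 / 10) p = α at *
  generalize beta σ (1 / 10) p = β at *
  have hk : 0 < K / 3 := by linarith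
  generalize K / 3 = k at *
  have t1 : α * cc * (1 - 0.995) ≤ 0.0089 := by
    have : α * cc ≤ 1.0067 * 1.76 := by gcongr
    linarith
  have t2 : 1.04 * p * α + 0.995 * (p * α) ≤ 2.05 * p := by
    have : p * α ≤ p * 1.0067 := by gcongr
    linarith
  have t3 : 1.948 * β ≤ 0.986 * β + 0.995 * ((1 - p) * β) := by
    have : p * β ≤ 0.0325 * β := by gcongr
    linarith
  have t4 : 1.04 * p * α + 0.995 * (p * α) - (0.986 * β + 0.995 * ((1 - p) * β)) ≤
      5.99 * p - 0.1554 := by linarith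
  have t5 := mul_le_mul_of_nonneg_left t4 hk.le
  linarith

/-- At the end `ε = 1/10` of the range of parameters, `Ffun` is negative. -/
theorem Adm.Ffun_neg (h : Adm σ (1 / 10) p) (hκ0 : 0.3 ≤ κ) (hκ : κ ≤ 0.57)
    (hp : p = κ ^ 2 * (1 / 10)) : Ffun σ (1 / 10) p κ < 0 := by
  have hE := h.le_hInt_WE
  have hsub := h.hInt_WE_sub_WA_le
  have hIJ : hInt (VI σ (1 / 10) p) ≤ hInt (VJ σ (1 / 10) p) :=
    hInt_mono h.HInt_VI h.HInt_VJ fun t ht => h.VI_le_VJ ht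
  have hJ := h.le_hInt_VJ
  have hr := h.le_ratio (κ := κ) (by linarith)
  have hr2 := h.ratio_le hκ
  have hK := K_le
  have hK0 := le_K
  unfold Ffun
  generalize hInt (WE σ (1 / 10) p) = E at *
  generalize hInt (WA σ (1 / 10) p) = A at *
  generalize hInt (VI σ (1 / 10) p) = i at *
  generalize hInt (VJ σ (1 / 10) p) = j at *
  generalize ratio σ (1 / 10) p κ = x at *
  -- The chord of the parabola over [0.3, 0.57] makes the remaining estimate linear in κ.
  have hκ2 : κ ^ 2 ≤ 0.87 * κ - 0.171 := by nlinarith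
  have h1 : K / 3 * (5.99 * p - 0.1554) ≤ 0.0996 * 1.38 * κ - 0.009 := by
    have e : 5.99 * p - 0.1554 ≤ 0.5212 * κ - 0.2578 := by rw [hp]; linarith
    refine (mul_le_mul_of_nonneg_left e (by linarith)).trans ?_
    rcases le_or_gt (0.5212 * κ) 0.2578 with hs | hs
    · have : K / 3 * (0.5212 * κ - 0.2578) ≤ 0 :=
        mul_nonpos_of_nonneg_of_nonpos (by linarith) (by linarith)
      linarith
    · have : K / 3 * (0.5212 * κ - 0.2578) ≤ 1.2567 * (0.5212 * κ - 0.2578) := by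
        gcongr
        linarith
      linarith
  have h2 : 0.0996 * 1.38 * κ ≤ x * E := by
    calc 0.0996 * 1.38 * κ = 0.0996 * κ * 1.38 := by ring
      _ ≤ x * E := by
        have : 0 ≤ x := by linarith
        gcongr
  have h3 : E * (1 - x) < A := by linarith
  have h4 : E * i * (1 - x) ≤ E * (1 - x) * j := by
    have : 0 ≤ E * (1 - x) := mul_nonneg (by linarith) (by linarith)
    nlinarith
  have h5 : E * (1 - x) * j < A * j := by
    gcongr
  linarith

/-! ### The end `σ = 10 ε` -/

/-- Writing D and D' for the denominators built from X and Y, the claim is α(D - D') + Bt(D + D') ≥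
0. The first bracket is negative of order εt except near t = 0, where the lower bound on p keeps it
positive; the second term compensates because B ≥ 19ε. -/
theorem high_end_ineq {X Y s k k₁ α B : ℝ} (hε : 0 < ε) (hε2 : ε ≤ 0.001) (hp : 0.09 * ε ≤ p)
    (hp2 : p ≤ 0.325 * ε) (ht : 0 < t) (hs : 1 ≤ s) (hs2 : s ^ 2 = 1 + t ^ 2)
    (hX2 : X ^ 2 = s ^ 2 - 20 * ε * t) (hY2 : Y ^ 2 = s ^ 2 + 20 * ε * t)
    (hX : 0.99 * s ≤ X) (hXs : X ≤ s) (hY : s ≤ Y) (hk : 0.9999 ≤ k) (hk2 : k ≤ 1.005)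
    (hk₁ : 1 ≤ k₁) (hk₁2 : k₁ ≤ 1.0001) (hα : 0.9989 ≤ α) (hα2 : α ≤ 1.001)
    (hB : 19 * ε ≤ B) :
    (α + -B * t) * (Y * (k₁ * Y + k * (t + -p))) ≤
      (α + B * t) * (X * (k₁ * X + k * (t + p))) := by
  have hp0 : 0 < p := by linarith
  have hd0 : 0 ≤ Y - X := by linarith
  have hdS : (Y - X) * (X + Y) = 40 * ε * t := by linear_combination hY2 - hX2
  have hsum : 1.99 ≤ X + Y := by linarith
  have hd : Y - X ≤ 20.11 * (ε * t) := by
    have : (Y - X) * 1.99 ≤ (Y - X) * (X + Y) := by gcongr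
    linarith [mul_pos hε ht]
  have n1 : 0.179 * ε ≤ k * (p * (X + Y)) := by
    calc 0.179 * ε ≤ 0.9999 * (0.09 * ε * 1.99) := by linarith
      _ ≤ _ := by gcongr
  have n2 : k * (t * (Y - X)) ≤ 20.22 * (ε * t ^ 2) := by
    calc k * (t * (Y - X)) ≤ 1.005 * (t * (20.11 * (ε * t))) := by gcongr
      _ ≤ _ := by nlinarith [mul_pos hε (pow_pos ht 2)]
  have n3 : 40 * ε * t * k₁ ≤ 40.004 * (ε * t) := by
    have : ε * t * k₁ ≤ ε * t * 1.0001 := by gcongr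
    linarith
  have n4 : ε * (0.179 - 40.004 * t - 20.22 * t ^ 2) ≤
      X * (k₁ * X + k * (t + p)) - Y * (k₁ * Y + k * (t + -p)) := by
    have e : X * (k₁ * X + k * (t + p)) - Y * (k₁ * Y + k * (t + -p)) =
        k * (p * (X + Y)) - k * (t * (Y - X)) - 40 * ε * t * k₁ := by
      linear_combination k₁ * hX2 - k₁ * hY2
    rw [e]
    linarith
  have n5 : 2 * (1 + t ^ 2) + 1.97 * t ≤
      X * (k₁ * X + k * (t + p)) + Y * (k₁ * Y + k * (t + -p)) := by
    have e : X * (k₁ * X + k * (t + p)) + Y * (k₁ * Y + k * (t + -p)) =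
        k₁ * (2 * (1 + t ^ 2)) + k * (t * (X + Y) - p * (Y - X)) := by
      linear_combination k₁ * hX2 + k₁ * hY2 + 2 * k₁ * hs2
    have h1 : p * (Y - X) ≤ 0.01 * t := by
      have hp3 : p ≤ 0.001 := by linarith
      calc p * (Y - X) ≤ 0.001 * (20.11 * (ε * t)) := by gcongr
        _ ≤ 0.001 * (20.11 * (0.001 * t)) := by gcongr
        _ ≤ _ := by linarith
    have h2 : t * 1.99 ≤ t * (X + Y) := by gcongr
    have h3 : 1.98 * t ≤ t * (X + Y) - p * (Y - X) := by linarith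
    have h4 : 0.9999 * (1.98 * t) ≤ k * (t * (X + Y) - p * (Y - X)) := by gcongr
    have h5 : 1 * (2 * (1 + t ^ 2)) ≤ k₁ * (2 * (1 + t ^ 2)) := by gcongr
    rw [e]
    linarith
  have n6 := mul_le_mul_of_nonneg_left n4 (a := α) (by linarith)
  have n7 : 19 * ε * t * (2 * (1 + t ^ 2) + 1.97 * t) ≤
      B * t * (X * (k₁ * X + k * (t + p)) + Y * (k₁ * Y + k * (t + -p))) := by
    have hB0 : 0 ≤ B := by linarith
    gcongr
  have n8 : 0.178 - 40.05 * t - 20.25 * t ^ 2 ≤ α * (0.179 - 40.004 * t - 20.22 * t ^ 2) := by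
    have h1 : α * t ≤ 1.001 * t := by gcongr
    have h2 : α * t ^ 2 ≤ 1.001 * t ^ 2 := by gcongr
    linarith [sq_nonneg t]
  have n9 := mul_le_mul_of_nonneg_left n8 hε.le
  -- The cubic is 0.178 - 2.05t + 17.18t² + 38t³, and its quadratic part already has negative
  -- discriminant.
  have n10 : 0 ≤ 0.178 - 40.05 * t - 20.25 * t ^ 2 + 19 * t * (2 * (1 + t ^ 2) + 1.97 * t) := by
    nlinarith [sq_nonneg (t - 0.1), pow_pos ht 3]
  have n11 := mul_nonneg hε.le n10
  linarith

theorem Adm.high_WA_le_WE (h : Adm (10 * ε) ε p) (ht : 0 < t) :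
    WA (10 * ε) ε p t ≤ WE (10 * ε) ε p t := by
  have hdA := h.denA_pos ht
  have hdE := h.denE_pos ht
  have hε := h.ε_pos
  have hε2 : ε ≤ 0.001 := by linarith [h.σ_lt]
  have hp := h.p_pos
  have hp2 : p ≤ 0.001 := by linarith [h.p_le]
  have hpε : p * ε ≤ 0.001 * 0.001 := by gcongr
  have hpε0 := h.pε_pos
  have hS2 := S_sq t
  have hX2 := R_sq h.abs_σ t
  have hY2 := R_sq h.abs_neg_σ t
  have hα : alpha (10 * ε) ε p ≤ 1.001 := by
    have e : alpha (10 * ε) ε p = 1 - p ^ 2 + 2 * (p * ε) + 20 * (p * ε) ^ 2 := by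
      unfold alpha; ring
    have h1 : (p * ε) ^ 2 ≤ (0.001 * 0.001) ^ 2 := by gcongr
    rw [e]
    linarith [sq_nonneg p]
  have hβ : 19 * ε ≤ -beta (10 * ε) ε p := by
    have : 0 < ε * p ^ 2 := by positivity
    unfold beta
    linarith
  unfold WA WE W
  rw [div_le_div_iff₀ hdA hdE]
  have key := high_end_ineq (X := R (10 * ε) t) (Y := R (-(10 * ε)) t) hε hε2 h.le_p h.p_le ht
    (one_le_S t) hS2 (by rw [hX2, hS2]; ring) (by rw [hY2, hS2]; ring)
    (le_R h.σ_pos.le h.σ_lt.le) (R_le_S h.σ_pos.le ht) (S_le_R_neg h.σ_pos.le ht)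
    h.le_k2 h.k2_le (k₁ := 1 + p * ε) (by linarith) (by linarith) h.le_alpha hα hβ
  rwa [neg_neg] at key

/-- Since b ≥ σ = 10ε in the notation `bb`, the denominators differ by at least 40εtS, giving a gain
38εt/S⁵. The numerators 1 ∓ εt cost at most 2.06εt/S³. Integration leaves a multiple of ε·`cc`. -/
theorem Adm.high_VI_sub_VJ (h : Adm (10 * ε) ε p) :
    6 * ε ≤ hInt (VI (10 * ε) ε p) - hInt (VJ (10 * ε) ε p) := by
  have hε := h.ε_pos
  have hb := h.le_bb
  have hI := hInt_mono (((HInt_t_five.const_mul (38 * ε)).add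
    (HInt_t_cube.const_mul (-(2.06 * ε)))).add h.HInt_VJ) h.HInt_VI fun t ht => by
      have hS := S_pos t
      have hdI := h.denI_pos t
      have hdJ := h.denJ_pos ht
      have hI1 := h.le_denI t
      have hI2 := h.denI_le ht
      have hJ1 := h.le_denJ ht
      have hJ2 := h.denJ_le ht
      have hgap : S t * (40 * ε * t) ≤
          R (-(10 * ε)) t * (t ^ 2 - 2 * -bb (10 * ε) ε p * t + mm (10 * ε) ε p) -
          R (10 * ε) t * (t ^ 2 - 2 * bb (10 * ε) ε p * t + mm (10 * ε) ε p) := by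
        have h1 : R (10 * ε) t * (t ^ 2 - 2 * bb (10 * ε) ε p * t + mm (10 * ε) ε p) ≤
            S t * (t ^ 2 - 2 * bb (10 * ε) ε p * t + mm (10 * ε) ε p) := by
          refine mul_le_mul_of_nonneg_right (R_le_S h.σ_pos.le ht) ?_
          exact le_trans (by positivity) (h.le_quadI t)
        have h2 : S t * (t ^ 2 - 2 * -bb (10 * ε) ε p * t + mm (10 * ε) ε p) ≤
            R (-(10 * ε)) t * (t ^ 2 - 2 * -bb (10 * ε) ε p * t + mm (10 * ε) ε p) := by
          refine mul_le_mul_of_nonneg_right (S_le_R_neg h.σ_pos.le ht) ?_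
          exact le_trans (by positivity) (h.le_quadJ ht)
        have h3 : S t * (40 * ε * t) ≤ S t * (4 * bb (10 * ε) ε p * t) := by
          refine mul_le_mul_of_nonneg_left ?_ hS.le
          linarith [mul_le_mul_of_nonneg_right hb ht.le]
        linarith
      unfold VI VJ V
      generalize R (10 * ε) t * (t ^ 2 - 2 * bb (10 * ε) ε p * t + mm (10 * ε) ε p) = D at *
      generalize R (-(10 * ε)) t * (t ^ 2 - 2 * -bb (10 * ε) ε p * t + mm (10 * ε) ε p) = D' at *
      have hS3 : 0 < S t ^ 3 := by positivity
      have a1 : t / D ≤ 1.05 * (t / S t ^ 3) := by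
        rw [mul_div_assoc', div_le_div_iff₀ hdI hS3]
        have := mul_le_mul_of_nonneg_left hI1 ht.le
        linarith [mul_pos ht hS3, mul_pos ht hdI]
      have a2 : t / D' ≤ 1.01 * (t / S t ^ 3) := by
        rw [mul_div_assoc', div_le_div_iff₀ hdJ hS3]
        have := mul_le_mul_of_nonneg_left hJ1 ht.le
        linarith [mul_pos ht hS3, mul_pos ht hdJ]
      have a3 : 38 * (ε * t / S t ^ 5) ≤ 1 / D - 1 / D' := by
        have e : 1 / D - 1 / D' = (D' - D) / (D * D') := by field_simp
        have h1 : D * D' ≤ 1.002 * S t ^ 3 * (1.034 * S t ^ 3) := by gcongr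
        have h2 : S t * (40 * ε * t) / (1.002 * S t ^ 3 * (1.034 * S t ^ 3)) ≤
            (D' - D) / (D * D') := by
          have : 0 ≤ S t * (40 * ε * t) := by positivity
          have : 0 ≤ D' - D := this.trans hgap
          gcongr
        rw [e]
        refine le_trans ?_ h2
        rw [mul_div_assoc', div_le_div_iff₀ (by positivity) (by positivity)]
        have : 0 < ε * t * S t ^ 6 := by positivity
        linarith
      have a4 := mul_le_mul_of_nonneg_left a1 hε.le
      have a5 := mul_le_mul_of_nonneg_left a2 hε.le
      have e1 : (1 - ε * t) / D = 1 / D - ε * (t / D) := by ring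
      have e2 : (1 - -ε * t) / D' = 1 / D' + ε * (t / D') := by ring
      have e3 : 38 * ε * (t / S t ^ 5) = 38 * (ε * t / S t ^ 5) := by ring
      rw [e1, e2, e3]
      linarith
  rw [hInt_add ((HInt_t_five.const_mul _).add (HInt_t_cube.const_mul _)) h.HInt_VJ,
    hInt_add (HInt_t_five.const_mul _) (HInt_t_cube.const_mul _), hInt_const_mul,
    hInt_const_mul, hInt_t_five, hInt_t_cube] at hI
  have hc := mul_le_mul_of_nonneg_left le_cc hε.le
  linarith

/-- The surplus 6ε of `VI` over `VJ` exceeds the loss 1.98·0.58ε caused by `ratio`, and `WE`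
dominates `WA`. -/
theorem Adm.Ffun_pos (h : Adm (10 * ε) ε p) (hκ : κ ≤ 0.57) :
    0 < Ffun (10 * ε) ε p κ := by
  have hE := h.le_hInt_WE
  have hAE : hInt (WA (10 * ε) ε p) ≤ hInt (WE (10 * ε) ε p) :=
    hInt_mono h.HInt_WA h.HInt_WE fun t ht => h.high_WA_le_WE ht
  have hIJ := h.high_VI_sub_VJ
  have hI := h.hInt_VI_le
  have hI0 := h.hInt_VI_pos
  have hJ := h.le_hInt_VJ
  have hr := h.ratio_le hκ
  have hε := h.ε_pos
  unfold Ffun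
  generalize hInt (WE (10 * ε) ε p) = E at *
  generalize hInt (WA (10 * ε) ε p) = A at *
  generalize hInt (VI (10 * ε) ε p) = i at *
  generalize hInt (VJ (10 * ε) ε p) = j at *
  generalize ratio (10 * ε) ε p κ = x at *
  have h1 : i * x ≤ 1.98 * (0.58 * ε) := by
    refine (mul_le_mul_of_nonneg_left hr (by linarith)).trans ?_
    gcongr
  have h2 : j < i * (1 - x) := by linarith
  have h3 : E * j < E * (i * (1 - x)) := by gcongr
  have h4 : A * j ≤ E * j := by gcongr
  linarith

end Signs

/-! ### Continuity in the parameters and the common zero -/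

section Continuity

variable {σ : ℝ}

theorem continuousOn_hInt {X : Type*} [TopologicalSpace X] [FirstCountableTopology X]
    {g : X → ℝ → ℝ} {s : Set X} {C : ℝ} (hg : ∀ x ∈ s, ContinuousOn (g x) (Ioi 0))
    (hb : ∀ x ∈ s, ∀ t, 0 < t → |g x t| ≤ C / S t)
    (hc : ∀ t, 0 < t → ContinuousOn (fun x => g x t) s) : ContinuousOn (fun x => hInt (g x)) s := by
  refine continuousOn_of_dominated (bound := fun t => C * (1 / S t / √t)) ?_ ?_
    (Integrable.const_mul hInt_one_div_S_exists C) ?_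
  · intro x hx
    refine ContinuousOn.aestronglyMeasurable ?_ measurableSet_Ioi
    exact (hg x hx).div Real.continuous_sqrt.continuousOn fun t ht => sqrt_ne ht
  · intro x hx
    refine (ae_restrict_iff' measurableSet_Ioi).mpr (ae_of_all _ fun t ht => ?_)
    rw [norm_div, Real.norm_eq_abs, Real.norm_of_nonneg (Real.sqrt_nonneg t), ← mul_div_assoc,
      mul_one_div]
    have := hb x hx t ht
    gcongr
  · refine (ae_restrict_iff' measurableSet_Ioi).mpr (ae_of_all _ fun t ht => ?_)
    exact (hc t ht).div_const _

/-- The rectangle of the parameters `(ε, κ)`. -/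
def rect (σ : ℝ) : Set (ℝ × ℝ) := Icc (σ / 10) (1 / 10) ×ˢ Icc 0.3 0.57

theorem adm_of_mem (hσ : 0 < σ) (hσ2 : σ < 1 / 100) {z : ℝ × ℝ} (hz : z ∈ rect σ) :
    Adm σ z.1 (z.2 ^ 2 * z.1) := by
  obtain ⟨⟨h1, h2⟩, h3, h4⟩ := hz
  have hε : 0 < z.1 := by linarith
  -- The bounds on p come from 0.3² = 0.09 and 0.57² = 0.3249.
  refine ⟨hσ, hσ2, by linarith, hε, h2, ?_, ?_⟩
  · gcongr
    nlinarith
  · gcongr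
    nlinarith

theorem continuous_R_right {X : Type*} [TopologicalSpace X] {u v : X → ℝ} (hu : Continuous u)
    (hv : Continuous v) : Continuous fun x => R (u x) (v x) := by
  unfold R
  fun_prop

theorem continuousOn_mm (hσ : 0 < σ) (hσ2 : σ < 1 / 100) :
    ContinuousOn (fun z : ℝ × ℝ => mm σ z.1 (z.2 ^ 2 * z.1)) (rect σ) := by
  refine ContinuousOn.div (by fun_prop) (by fun_prop) fun z hz => ?_
  have := (adm_of_mem hσ hσ2 hz).pε_pos
  positivity

theorem continuousOn_bb (hσ : 0 < σ) (hσ2 : σ < 1 / 100) :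
    ContinuousOn (fun z : ℝ × ℝ => bb σ z.1 (z.2 ^ 2 * z.1)) (rect σ) := by
  have := continuousOn_mm hσ hσ2
  unfold bb
  fun_prop

theorem continuousOn_aa (hσ : 0 < σ) (hσ2 : σ < 1 / 100) :
    ContinuousOn (fun z : ℝ × ℝ => aa σ z.1 (z.2 ^ 2 * z.1)) (rect σ) := by
  have := continuousOn_mm hσ hσ2
  have := continuousOn_bb hσ hσ2
  unfold aa
  fun_prop

theorem continuousOn_hInt_WA (hσ : 0 < σ) (hσ2 : σ < 1 / 100) :
    ContinuousOn (fun z : ℝ × ℝ => hInt (WA σ z.1 (z.2 ^ 2 * z.1))) (rect σ) := by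
  refine continuousOn_hInt (fun z hz => (adm_of_mem hσ hσ2 hz).continuousOn_WA)
    (fun z hz t ht => (adm_of_mem hσ hσ2 hz).abs_WA_le ht) fun t ht => ?_
  have h1 : Continuous fun z : ℝ × ℝ => R σ z.1 := continuous_R_right (by fun_prop) (by fun_prop)
  unfold WA W alpha beta
  refine ContinuousOn.div (by fun_prop) (by fun_prop) fun z hz => ?_
  exact ((adm_of_mem hσ hσ2 hz).denA_pos ht).ne'

theorem continuousOn_hInt_WE (hσ : 0 < σ) (hσ2 : σ < 1 / 100) :
    ContinuousOn (fun z : ℝ × ℝ => hInt (WE σ z.1 (z.2 ^ 2 * z.1))) (rect σ) := by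
  refine continuousOn_hInt (fun z hz => (adm_of_mem hσ hσ2 hz).continuousOn_WE)
    (fun z hz t ht => (adm_of_mem hσ hσ2 hz).abs_WE_le ht) fun t ht => ?_
  have h1 : Continuous fun z : ℝ × ℝ => R σ z.1 := continuous_R_right (by fun_prop) (by fun_prop)
  unfold WE W alpha beta
  refine ContinuousOn.div (by fun_prop) (by fun_prop) fun z hz => ?_
  exact ((adm_of_mem hσ hσ2 hz).denE_pos ht).ne'

theorem continuousOn_hInt_VI (hσ : 0 < σ) (hσ2 : σ < 1 / 100) :
    ContinuousOn (fun z : ℝ × ℝ => hInt (VI σ z.1 (z.2 ^ 2 * z.1))) (rect σ) := by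
  refine continuousOn_hInt (fun z hz => (adm_of_mem hσ hσ2 hz).continuousOn_VI)
    (fun z hz t ht => (adm_of_mem hσ hσ2 hz).abs_VI_le ht) fun t ht => ?_
  have h1 := continuousOn_mm hσ hσ2
  have h2 := continuousOn_bb hσ hσ2
  unfold VI V
  refine ContinuousOn.div (by fun_prop) (by fun_prop) fun z hz => ?_
  exact ((adm_of_mem hσ hσ2 hz).denI_pos t).ne'

theorem continuousOn_hInt_VJ (hσ : 0 < σ) (hσ2 : σ < 1 / 100) :
    ContinuousOn (fun z : ℝ × ℝ => hInt (VJ σ z.1 (z.2 ^ 2 * z.1))) (rect σ) := by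
  refine continuousOn_hInt (fun z hz => (adm_of_mem hσ hσ2 hz).continuousOn_VJ)
    (fun z hz t ht => (adm_of_mem hσ hσ2 hz).abs_VJ_le ht) fun t ht => ?_
  have h1 := continuousOn_mm hσ hσ2
  have h2 := continuousOn_bb hσ hσ2
  unfold VJ V
  refine ContinuousOn.div (by fun_prop) (by fun_prop) fun z hz => ?_
  exact ((adm_of_mem hσ hσ2 hz).denJ_pos ht).ne'

theorem continuousOn_Gfun (hσ : 0 < σ) (hσ2 : σ < 1 / 100) :
    ContinuousOn (fun z : ℝ × ℝ => Gfun σ z.1 (z.2 ^ 2 * z.1) z.2) (rect σ) := by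
  have h1 := continuousOn_hInt_WE hσ hσ2
  have h2 := continuousOn_hInt_VJ hσ hσ2
  have h3 := continuousOn_aa hσ hσ2
  have h4 : Continuous fun z : ℝ × ℝ => R (-σ) (z.2 ^ 2 * z.1) :=
    continuous_R_right (by fun_prop) (by fun_prop)
  exact h1.sub ((((continuousOn_const.mul h3).mul h4.continuousOn).mul continuousOn_snd).mul h2)

theorem continuousOn_Ffun (hσ : 0 < σ) (hσ2 : σ < 1 / 100) :
    ContinuousOn (fun z : ℝ × ℝ => Ffun σ z.1 (z.2 ^ 2 * z.1) z.2) (rect σ) := by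
  have h1 := continuousOn_hInt_WE hσ hσ2
  have h2 := continuousOn_hInt_VJ hσ hσ2
  have h3 := continuousOn_aa hσ hσ2
  have h4 : Continuous fun z : ℝ × ℝ => R σ z.1 := continuous_R_right (by fun_prop) (by fun_prop)
  have h5 := continuousOn_hInt_WA hσ hσ2
  have h6 := continuousOn_hInt_VI hσ hσ2
  have h7 := continuousOn_mm hσ hσ2
  have h8 : ContinuousOn (fun z : ℝ × ℝ => ratio σ z.1 (z.2 ^ 2 * z.1) z.2) (rect σ) := by
    unfold ratio
    refine ContinuousOn.div (by fun_prop) (by fun_prop) fun z hz => ?_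
    have h := adm_of_mem hσ hσ2 hz
    have := h.pε_pos
    have := h.le_aa
    positivity
  unfold Ffun
  fun_prop

/-- The reduced equations have a common solution. -/
theorem exists_reduced_solution (hσ : 0 < σ) (hσ2 : σ < 1 / 100) :
    ∃ ε κ : ℝ, (ε, κ) ∈ rect σ ∧ Ffun σ ε (κ ^ 2 * ε) κ = 0 ∧ Gfun σ ε (κ ^ 2 * ε) κ = 0 := by
  have hmem : ∀ {ε κ : ℝ}, ε ∈ Icc (σ / 10) (1 / 10) → κ ∈ Icc (0.3 : ℝ) 0.57 →
      Adm σ ε (κ ^ 2 * ε) := fun h1 h2 => adm_of_mem hσ hσ2 (z := (_, _)) ⟨h1, h2⟩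
  have hle : σ / 10 ≤ 1 / 10 := by linarith
  suffices ∃ ε ∈ Icc (σ / 10) (1 / 10), ∃ κ ∈ Icc (0.3 : ℝ) 0.57,
      -Ffun σ ε (κ ^ 2 * ε) κ = 0 ∧ -Gfun σ ε (κ ^ 2 * ε) κ = 0 by
    obtain ⟨ε, hε, κ, hκ, hF, hG⟩ := this
    exact ⟨ε, κ, ⟨hε, hκ⟩, neg_eq_zero.mp hF, neg_eq_zero.mp hG⟩
  -- Both functions are negated because each is positive on the lower side of its variable, ε = σ/10
  -- or κ = 0.3.
  refine exists_common_zero hle (by norm_num) (continuousOn_Ffun hσ hσ2).neg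
    (continuousOn_Gfun hσ hσ2).neg
    (fun κ hκ => ?_) (fun κ hκ => ?_) (fun ε hε => ?_) (fun ε hε => ?_)
  · have h := hmem (left_mem_Icc.mpr hle) hκ
    have e : σ = 10 * (σ / 10) := by ring
    have h' : Adm (10 * (σ / 10)) (σ / 10) (κ ^ 2 * (σ / 10)) := by rwa [← e]
    have := h'.Ffun_pos hκ.2
    rw [← e] at this
    exact neg_neg_of_pos this
  · have h := hmem (right_mem_Icc.mpr hle) hκ
    exact neg_pos_of_neg (h.Ffun_neg hκ.1 hκ.2 rfl)
  · have h := hmem hε (left_mem_Icc.mpr (by norm_num))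
    exact neg_neg_of_pos h.Gfun_pos
  · have h := hmem hε (right_mem_Icc.mpr (by norm_num))
    exact neg_pos_of_neg h.Gfun_neg

end Continuity

/-! ### Return to the original parameters -/

variable {σ ε p : ℝ}

/-- The constant coefficient gives r² = pε²m and the quadratic one gives b. Substituted in the
linear one, they leave m(1 + pε)² = 1 + 2σp + p², which is the definition of `mm`. -/
theorem Adm.cubic (h : Adm σ ε p) {r : ℝ} (hr : r ^ 2 = p * ε ^ 2 * mm σ ε p) :
    Cubic σ ε⁻¹ r p (aa σ ε p) (-bb σ ε p) := by
  have hε := h.ε_pos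
  have hpε := h.pε_pos
  have hm : mm σ ε p * (1 + p * ε) ^ 2 = 1 + 2 * σ * p + p ^ 2 := by
    rw [mm, div_mul_cancel₀]
    positivity
  have hab : aa σ ε p ^ 2 + (-bb σ ε p) ^ 2 = mm σ ε p := by
    rw [h.aa_sq]
    ring
  have hbb : 2 * bb σ ε p = 2 * σ + p - p * ε ^ 2 * mm σ ε p := by
    unfold bb
    ring
  refine ⟨?_, ?_, ?_⟩
  · rw [hr]
    linear_combination (-1) * hbb
  · rw [hab, hr]
    field_simp
    linear_combination hm - p * hbb
  · rw [hab, hr]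
    field_simp

theorem lt_r0 (ρ : ℝ) : 0.3 < r0 ρ := by
  have h : 0.4 ≤ √(y0 * (y0 ^ 2 + 2 * |Real.sin ρ| * y0 + 1)) := by
    refine Real.le_sqrt_of_sq_le ?_
    have := abs_nonneg (Real.sin ρ)
    unfold y0
    linarith
  have hy : (0 : ℝ) < y0 + 1 := by
    unfold y0
    norm_num
  rw [r0, lt_div_iff₀ hy]
  refine lt_of_lt_of_le ?_ h
  unfold y0
  norm_num

theorem exists_periods {ρ : ℝ} (hσ : Real.sin ρ = -σ) (hσ0 : 0 < σ) (hσ2 : σ < 1 / 100) :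
    ∃ lam r a b : ℝ, 1 < lam ∧ 0 < r ∧ lam * r < r0 ρ ∧ 0 < a ∧ (∃ p, Cubic σ lam r p a b) ∧
      2 * a * f ρ lam * r - r ^ 2 * ((lam + b) ^ 2 + a ^ 2) ≠ 0 ∧
      ∃ C : ℝ, 0 < C ∧ C = c1 ρ lam r a b ∧ IsC2 ρ lam a b C ∧ IsC3 ρ lam a b C := by
  obtain ⟨ε, κ, hmem, hF, hG⟩ := exists_reduced_solution hσ0 hσ2
  have h : Adm σ ε (κ ^ 2 * ε) := adm_of_mem hσ0 hσ2 hmem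
  have hκ0 : 0.3 ≤ κ := hmem.2.1
  have hκ1 : κ ≤ 0.57 := hmem.2.2
  have hκp : 0 < κ := by linarith
  generalize hp : κ ^ 2 * ε = p at *
  have hε := h.ε_pos
  have hε1 := h.ε_le
  have hpp := h.p_pos
  have hpε := h.pε_pos
  have hm0 := h.le_mm
  have ha : 0 < aa σ ε p := by linarith [h.le_aa]
  have hs := Real.sqrt_pos.mpr hε
  have hs2 := Real.sq_sqrt hε.le
  have hg : 0 < √(mm σ ε p) := Real.sqrt_pos.mpr (by linarith)
  have hg2 : √(mm σ ε p) ^ 2 = mm σ ε p := Real.sq_sqrt (by linarith)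
  have hgle := h.sqrt_mm_le
  have hlam : 0 < ε⁻¹ := inv_pos.mpr hε
  -- This is r: the positive square root of pε²m, with p = κ²ε.
  have hr : 0 < κ * ε * √ε * √(mm σ ε p) := by positivity
  have hr2 : (κ * ε * √ε * √(mm σ ε p)) ^ 2 = p * ε ^ 2 * mm σ ε p := by
    rw [mul_pow, mul_pow, hg2, hs2, ← hp]
    ring
  have hcub := h.cubic hr2
  have hI := h.hInt_VI_pos
  have hJ := h.le_hInt_VJ
  have hab : aa σ ε p ^ 2 + (-bb σ ε p) ^ 2 = mm σ ε p := by
    rw [h.aa_sq]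
    ring
  have hRp : R (-σ) p = √(mm σ ε p) * (1 + p * ε) := by
    have e : p ^ 2 - 2 * -σ * p + 1 = mm σ ε p * (1 + p * ε) ^ 2 := by
      rw [mm, div_mul_cancel₀ _ (by positivity)]
      ring
    rw [R, e, Real.sqrt_mul (by linarith), Real.sqrt_sq (by positivity)]
  have hX := R_pos h.abs_σ ε⁻¹
  have hRε : R σ ε = R σ ε⁻¹ * ε := by
    have := R_inv (σ := σ) hlam
    rw [inv_inv] at this
    rw [this, div_inv_eq_mul]
  have hH : (ε⁻¹ + p) / f ρ ε⁻¹ = (1 + p * ε) / (√ε * R σ ε⁻¹) := by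
    rw [f_eq hσ hlam.le, Real.sqrt_inv]
    generalize R σ ε⁻¹ = X at *
    field_simp
    linear_combination hs2
  have hx2 := h.ratio_le hκ1
  -- In other words `ratio` is r/(aH), so 2aHr - 2r² = 2aHr(1 - `ratio`); this turns the second
  -- equation into `Ffun` = 0.
  have hx : aa σ ε p * ((ε⁻¹ + p) / f ρ ε⁻¹) * ratio σ ε p κ = κ * ε * √ε * √(mm σ ε p) := by
    rw [hH, ratio, hRε]
    generalize R σ ε⁻¹ = X at *
    field_simp
    exact hs2.symm
  have hHpos : 0 < (ε⁻¹ + p) / f ρ ε⁻¹ := by rw [hH]; positivity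
  have hE : hInt (WE σ ε p) / R σ ε⁻¹ = 2 * aa σ ε p * (κ * ε * √ε * √(mm σ ε p)) *
      ((ε⁻¹ + p) / f ρ ε⁻¹) * (ε⁻¹ * hInt (VJ σ ε p)) := by
    have : hInt (WE σ ε p) = 2 * aa σ ε p * R (-σ) p * κ * hInt (VJ σ ε p) := by
      unfold Gfun at hG
      linarith
    rw [this, hH, hRp]
    field_simp
  have hA : hInt (WA σ ε p) / R σ ε⁻¹ = (2 * aa σ ε p * (κ * ε * √ε * √(mm σ ε p)) *
      ((ε⁻¹ + p) / f ρ ε⁻¹) - 2 * (κ * ε * √ε * √(mm σ ε p)) ^ 2) *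
      (ε⁻¹ * hInt (VI σ ε p)) := by
    have hA1 : hInt (WA σ ε p) * hInt (VJ σ ε p) =
        hInt (WE σ ε p) * hInt (VI σ ε p) * (1 - ratio σ ε p κ) := by
      unfold Ffun at hF
      linarith
    have hJ0 : hInt (VJ σ ε p) ≠ 0 := by linarith
    refine mul_right_cancel₀ hJ0 ?_
    calc hInt (WA σ ε p) / R σ ε⁻¹ * hInt (VJ σ ε p)
        = hInt (WA σ ε p) * hInt (VJ σ ε p) / R σ ε⁻¹ := by ring
      _ = hInt (WE σ ε p) / R σ ε⁻¹ * (hInt (VI σ ε p) * (1 - ratio σ ε p κ)) := by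
          rw [hA1]
          ring
      _ = _ := by
          rw [hE]
          linear_combination (-2 * (κ * ε * √ε * √(mm σ ε p)) * ε⁻¹ * hInt (VI σ ε p) *
            hInt (VJ σ ε p)) * hx
  have hC : 0 < 2 * aa σ ε p * (κ * ε * √ε * √(mm σ ε p)) * ((ε⁻¹ + p) / f ρ ε⁻¹) -
      (κ * ε * √ε * √(mm σ ε p)) ^ 2 := by
    have e : 2 * aa σ ε p * (κ * ε * √ε * √(mm σ ε p)) * ((ε⁻¹ + p) / f ρ ε⁻¹) -
        (κ * ε * √ε * √(mm σ ε p)) ^ 2 = (κ * ε * √ε * √(mm σ ε p)) *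
        (aa σ ε p * ((ε⁻¹ + p) / f ρ ε⁻¹)) * (2 - ratio σ ε p κ) := by
      linear_combination (κ * ε * √ε * √(mm σ ε p)) * hx
    rw [e]
    have : 0 < 2 - ratio σ ε p κ := by linarith
    positivity
  have hWA := h.HInt_WA
  have hWE := h.HInt_WE
  have hVI := h.HInt_VI
  have hVJ := h.HInt_VJ
  have hper := periods_of_reduced (lam := ε⁻¹) (p := p) (a := aa σ ε p) (b := -bb σ ε p)
    hσ h.abs_σ hlam hr hpp ha hcub
  rw [hab, inv_inv, neg_neg] at hper
  refine ⟨ε⁻¹, κ * ε * √ε * √(mm σ ε p), aa σ ε p, -bb σ ε p, ?_, hr, ?_, ha, ⟨p, hcub⟩, ?_⟩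
  · exact (one_lt_inv₀ hε).mpr (by linarith)
  · have hs3 : √ε ≤ 0.4 := Real.sqrt_le_iff.mpr ⟨by norm_num, by linarith⟩
    -- λr is of order √ε, so the bound ε ≤ 1/10 keeps it below 0.3 < r₀.
    have e : ε⁻¹ * (κ * ε * √ε * √(mm σ ε p)) = κ * √ε * √(mm σ ε p) := by field_simp
    rw [e]
    calc κ * √ε * √(mm σ ε p) ≤ 0.57 * 0.4 * 1.001 := by gcongr
      _ < 0.3 := by norm_num
      _ < _ := lt_r0 ρ
  · exact hper (fun t ht => right_ne_zero_of_mul (h.denA_pos ht).ne')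
      (fun t ht => right_ne_zero_of_mul (h.denE_pos ht).ne') hWA hWE hVI hVJ
      (by change hInt (VI σ ε p) ≠ 0; linarith) (by change hInt (VJ σ ε p) ≠ 0; linarith) hC hE hA

end ScherkCosta

end

theorem proposition7p1 (ρ : ℝ) (hρ : ρ ∈ Set.Ioo (-(1 / 100) : ℝ) 0) :
    ∃ lam r : ℝ, 1 < lam ∧ 0 < r ∧ r < ScherkCosta.r0 ρ ∧ lam * r < ScherkCosta.r0 ρ ∧
      ∃ x : ℂ, ScherkCosta.IsScherkEnd ρ lam r x ∧
        (∀ x' : ℂ, ScherkCosta.IsScherkEnd ρ lam r x' → x' = x) ∧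
        2 * x.re * ScherkCosta.f ρ lam * r - r ^ 2 * ((lam + x.im) ^ 2 + x.re ^ 2) ≠ 0 ∧
        ∃ C : ℝ, 0 < C ∧
          C = ScherkCosta.c1 ρ lam r x.re x.im ∧
          ScherkCosta.IsC2 ρ lam x.re x.im C ∧
          ScherkCosta.IsC3 ρ lam x.re x.im C := by
  obtain ⟨h1, h2⟩ := hρ
  have hsin : 0 < Real.sin (-ρ) := Real.sin_pos_of_pos_of_lt_pi (by linarith)
    (by linarith [Real.pi_gt_three])
  have hsin2 : Real.sin (-ρ) < 1 / 100 := (Real.sin_lt (by linarith)).trans (by linarith)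
  have hσ : Real.sin ρ = -Real.sin (-ρ) := by rw [Real.sin_neg, neg_neg]
  obtain ⟨lam, r, a, b, hlam, hr, hlr, ha, ⟨p, hcub⟩, hper⟩ :=
    ScherkCosta.exists_periods hσ hsin hsin2
  obtain ⟨hend, huniq⟩ := ScherkCosta.isScherkEnd_of_cubic hσ hcub ha
  have hrr : r < lam * r := lt_mul_of_one_lt_left hr hlam
  exact ⟨lam, r, hlam, hr, hrr.trans hlr, hlr, ⟨a, b⟩, hend, huniq, hper⟩
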